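/- **Theorem 3.2.** Let $G_1,G_2$ be probability measures on a measurable space $\mathcal X$, let $h:\mathcal X\to\mathbb R^d$ be measurable, and suppose that the density ratio model holds with true parameter $\theta_0=(\alpha_0,\beta_0)\in\mathbb R^{d+1}$: $$\frac{dG_1}{dG_2}(x)=\exp(\alpha_0+\beta_0'h(x)).$$ Let $X_{11},X_{12},\dots$ be i.i.d. with law $G_1$ and $X_{21},X_{22},\dots$ be i.i.d. with law $G_2$, the two sequences being independent. Observe the first $n_1$ variables of the first sequence and the first $n_2$ of the second, put $n=n_1+n_2$, and let $n\to\infty$ in such a way that $n_1/n_2\to\rho_1\in(0,\infty)$. For $\theta=(\alpha,\beta)$ the empirical log-likelihood is $$l(\theta)=-\sum_{i=1}^2\sum_{j=1}^{n_i}\log\Big[1+\frac{n_1}{n_2}e^{\alpha+\beta'h(X_{ij})}\Big]+\sum_{j=1}^{n_1}(\alpha+\beta'h(X_{1j})),$$ and the penalized one is $l_p(\theta)=l(\theta)-\lambda_n J(\beta)$, with the bridge penalty $J(\beta)=\sum_{j=1}^d|\beta_j|^q$, $q>1$, and $\lambda_n\ge 0$. Write $w_\theta(x)=e^{\alpha+\beta'h(x)}$,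 $z(x)=(1,h(x)')'\in\mathbb R^{d+1}$ and $$A=\int \frac{w_{\theta_0}}{1+\rho_1 w_{\theta_0}}\,zz'\,dG_2,\qquad S=\frac{\rho_1}{1+\rho_1}A,\qquad V=\frac{\rho_1}{1+\rho_1}A-\rho_1\,aa',$$ where $a$ is the first column of $A$. Assume the following regularity conditions: $A$ is nonsingular, and the Hessians in $\theta$ of $\log(1+\rho_1 w_\theta(x))$ are dominated near $\theta_0$, that is, there are $r>0$ and a function $K$, integrable under $G_1$ and under $G_2$, with $$\frac{\rho_1 w_\theta(x)}{(1+\rho_1 w_\theta(x))^2}\,\|z(x)\|^2\le K(x)\qquad\text{for all }x\in\mathcal X\text{ and all }\theta\text{ with }\|\theta-\theta_0\|<r.$$ Assume finally that $\lambda_n/\sqrt n\to\lambda_0\ge0$. Then, with probability tending to one, $l_p$ has a unique maximizer over $\mathbb R^{d+1}$; the matrix $\Sigma=S^{-1}VS^{-1}$ is positive semidefinite; and the penalized maximum empirical likelihood estimator $\hat\theta^\lambda$ (any random vector that maximizes $l_p$ with probability tending to one) satisfies $$\sqrt n\,(\hat\theta^\lambda-\theta_0)+\lambda_0S^{-1}b\;\longrightarrow\;\mathcal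 N_{d+1}(0,\,S^{-1}VS^{-1})\quad\text{in distribution},$$ where $b$ is the gradient at $\theta_0$ of $\theta=(\alpha,\beta)\mapsto J(\beta)$, that is $b=(0,\operatorname{sign}(\beta_{0,1})q|\beta_{0,1}|^{q-1},\dots,\operatorname{sign}(\beta_{0,d})q|\beta_{0,d}|^{q-1})'$. In particular, if $\lambda_0=0$, then $\sqrt n\,(\hat\theta^\lambda-\theta_0)\to\mathcal N_{d+1}(0,S^{-1}VS^{-1})$ in distribution. -/

import Mathlib

open MeasureTheory ProbabilityTheory Filter Topology

noncomputable section

namespace DensityRatio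

/-- The parameter space `ℝ^{d+1}`, with its Euclidean norm. A parameter is `θ = (α, β)`:
`θ 0` is the intercept `α` and `θ j.succ` is the coordinate `β_j` of the slope `β ∈ ℝ^d`. -/
abbrev Param (d : ℕ) : Type := EuclideanSpace ℝ (Fin (d + 1))

variable {𝒳 : Type*} {d : ℕ}

/-- The extended vector `z(x) = (1, h(x))` of `ℝ^{d+1}`. -/
def design (h : 𝒳 → Fin d → ℝ) (x : 𝒳) : Param d :=
  WithLp.toLp 2 (Fin.cons 1 (h x))

/-- The linear predictor `α + β' h(x)`. -/
def linPred (h : 𝒳 → Fin d → ℝ) (θ : Param d) (x : 𝒳) : ℝ :=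
  θ 0 + ∑ j : Fin d, θ j.succ * h x j

/-- The density ratio model with parameter `θ = (α, β)`: the law `G₁` has density
`exp (α + β' h(x))` with respect to the law `G₂`. -/
def DensityRatioModel [MeasurableSpace 𝒳] (h : 𝒳 → Fin d → ℝ) (θ : Param d)
    (G₁ G₂ : Measure 𝒳) : Prop :=
  G₁ = G₂.withDensity (fun x => ENNReal.ofReal (Real.exp (linPred h θ x)))

/-- The empirical log-likelihood of `θ` for a first sample `x₁ 0, …, x₁ (m₁ - 1)` and a
second sample `x₂ 0, …, x₂ (m₂ - 1)`, obtained from the nonparametric likelihood by profiling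
out the jumps of `G₂`; the weight in front of the exponential is the ratio `m₁ / m₂` of the
sample sizes. -/
def empLogLik (h : 𝒳 → Fin d → ℝ) (m₁ m₂ : ℕ) (x₁ x₂ : ℕ → 𝒳) (θ : Param d) : ℝ :=
  -(∑ j ∈ Finset.range m₁,
        Real.log (1 + (m₁ : ℝ) / (m₂ : ℝ) * Real.exp (linPred h θ (x₁ j)))
      + ∑ j ∈ Finset.range m₂,
        Real.log (1 + (m₁ : ℝ) / (m₂ : ℝ) * Real.exp (linPred h θ (x₂ j))))
    + ∑ j ∈ Finset.range m₁, linPred h θ (x₁ j)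

/-- The bridge penalty `J(β) = ∑_j |β_j|^q`, as a function of `θ = (α, β)`; the intercept is
not penalized. -/
def bridgePenalty (q : ℝ) (θ : Param d) : ℝ :=
  ∑ j : Fin d, |θ j.succ| ^ q

/-- The penalized empirical log-likelihood `l_p(θ) = l(θ) - lam * J(β)`. -/
def penLogLik (h : 𝒳 → Fin d → ℝ) (q lam : ℝ) (m₁ m₂ : ℕ) (x₁ x₂ : ℕ → 𝒳)
    (θ : Param d) : ℝ :=
  empLogLik h m₁ m₂ x₁ x₂ θ - lam * bridgePenalty q θ

/-- `θ` is a (global) maximizer of the penalized empirical log-likelihood. -/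
def IsPenMaximizer (h : 𝒳 → Fin d → ℝ) (q lam : ℝ) (m₁ m₂ : ℕ) (x₁ x₂ : ℕ → 𝒳)
    (θ : Param d) : Prop :=
  ∀ θ' : Param d, penLogLik h q lam m₁ m₂ x₁ x₂ θ' ≤ penLogLik h q lam m₁ m₂ x₁ x₂ θ

/-- The matrix `A = ∫ w / (1 + ρ w) z z' dG₂` with `z = (1, h(x))` and
`w = exp (α + β' h(x))`. -/
def matA [MeasurableSpace 𝒳] (h : 𝒳 → Fin d → ℝ) (ρ : ℝ) (θ : Param d) (G₂ : Measure 𝒳) :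
    Matrix (Fin (d + 1)) (Fin (d + 1)) ℝ :=
  Matrix.of fun i j =>
    ∫ x, Real.exp (linPred h θ x) / (1 + ρ * Real.exp (linPred h θ x))
      * (design h x i * design h x j) ∂G₂

/-- The matrix `S = ρ / (1 + ρ) A`. -/
def matS [MeasurableSpace 𝒳] (h : 𝒳 → Fin d → ℝ) (ρ : ℝ) (θ : Param d) (G₂ : Measure 𝒳) :
    Matrix (Fin (d + 1)) (Fin (d + 1)) ℝ :=
  (ρ / (1 + ρ)) • matA h ρ θ G₂

/-- The matrix `V = ρ / (1 + ρ) A - ρ a a'`, where `a` is the first column of the symmetric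
matrix `A`. -/
def matV [MeasurableSpace 𝒳] (h : 𝒳 → Fin d → ℝ) (ρ : ℝ) (θ : Param d) (G₂ : Measure 𝒳) :
    Matrix (Fin (d + 1)) (Fin (d + 1)) ℝ :=
  (ρ / (1 + ρ)) • matA h ρ θ G₂
    - ρ • Matrix.vecMulVec (fun i => matA h ρ θ G₂ i 0) (fun j => matA h ρ θ G₂ 0 j)

/-- The asymptotic covariance matrix `Σ = S⁻¹ V S⁻¹`. -/
def asympCov [MeasurableSpace 𝒳] (h : 𝒳 → Fin d → ℝ) (ρ : ℝ) (θ : Param d) (G₂ : Measure 𝒳) :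
    Matrix (Fin (d + 1)) (Fin (d + 1)) ℝ :=
  (matS h ρ θ G₂)⁻¹ * matV h ρ θ G₂ * (matS h ρ θ G₂)⁻¹

/-- The standard regularity condition on the likelihood: on a neighbourhood of `θ₀` the second
derivatives in `θ` of the contribution `log (1 + ρ exp (α + β' h(x)))` of one observation are
dominated by a function of `x` that is integrable under both laws. The Hessian of this
contribution is `ρ w / (1 + ρ w)² z z'` with `z = (1, h(x))`, `w = exp (α + β' h(x))`, and
`‖z‖² ρ w / (1 + ρ w)²` is its norm. -/
def DominatedHessian [MeasurableSpace 𝒳] (h : 𝒳 → Fin d → ℝ) (ρ : ℝ) (θ₀ : Param d)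
    (G₁ G₂ : Measure 𝒳) : Prop :=
  ∃ r : ℝ, 0 < r ∧ ∃ K : 𝒳 → ℝ, Integrable K G₁ ∧ Integrable K G₂ ∧
    ∀ θ ∈ Metric.ball θ₀ r, ∀ x : 𝒳,
      ρ * Real.exp (linPred h θ x) / (1 + ρ * Real.exp (linPred h θ x)) ^ 2
        * ‖design h x‖ ^ 2 ≤ K x

end DensityRatio

end

/-!
In the local coordinate `u = √n (θ - θ₀)`, with probability tending to one, `l_p` is strictly
concave and, uniformly on bounded sets, close up to a constant to the quadratic
`⟪u, S a⟫ - ⟪u, S u⟫ / 2`, where `S a` is `n^{-1/2}` times the score at `θ₀`, minus `λ₀ b`.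
Outside a small sphere around `a` a concave function stays below its value at `a` as soon as it
does so on the sphere, so the maximizer exists, is unique and is `o_P(1)`-close to `a`.

The offset `log (n₁ / n₂)` varies with the sample sizes, but the score is always exactly centered:
writing `σ` for the sigmoid function and `η` for the linear predictor, `dG₁ / dG₂ = e ^ η` gives
`n₁ ∫ (1 - σ (η + log (n₁ / n₂))) z dG₁ = n₂ ∫ σ (η + log (n₁ / n₂)) z dG₂`. Replacing the offset
by its limit `log ρ₁` in the centered score costs `o_P(√n)`, and the central limit theorem
applies.
-/

noncomputable section

namespace DensityRatio

open Real
open scoped InnerProductSpace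

/-! ### The sigmoid function and the softplus function -/

/-- The softplus function `log (1 + e ^ t)`, the cumulant function of logistic regression; its
derivative is the sigmoid function. -/
def softplus (t : ℝ) : ℝ := log (1 + exp t)

/-- The derivative `σ (1 - σ)` of the sigmoid function `σ`. -/
def sigmoidDeriv (t : ℝ) : ℝ := sigmoid t * (1 - sigmoid t)

lemma sigmoid_eq_exp_div (t : ℝ) : sigmoid t = exp t / (1 + exp t) := by
  rw [sigmoid_def, exp_neg]
  have := exp_pos t
  field_simp
  ring

lemma exp_mul_one_sub_sigmoid (t : ℝ) : exp t * (1 - sigmoid t) = sigmoid t := by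
  rw [sigmoid_eq_exp_div]
  have := exp_pos t
  field_simp
  ring

lemma sigmoidDeriv_eq (t : ℝ) : sigmoidDeriv t = exp t / (1 + exp t) ^ 2 := by
  rw [sigmoidDeriv, sigmoid_eq_exp_div]
  have := exp_pos t
  field_simp
  ring

lemma sigmoidDeriv_pos (t : ℝ) : 0 < sigmoidDeriv t := by
  rw [sigmoidDeriv_eq]; positivity

lemma sigmoidDeriv_le_one (t : ℝ) : sigmoidDeriv t ≤ 1 :=
  mul_le_one₀ (sigmoid_le_one t) (sub_nonneg.2 (sigmoid_le_one t))
    (sub_le_self _ (sigmoid_nonneg t))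

lemma continuous_sigmoidDeriv : Continuous sigmoidDeriv := by
  unfold sigmoidDeriv
  fun_prop

lemma hasDerivAt_softplus (t : ℝ) : HasDerivAt softplus (sigmoid t) t := by
  have h := ((hasDerivAt_exp t).const_add 1).log (by positivity)
  rwa [← sigmoid_eq_exp_div] at h

lemma strictConvexOn_softplus : StrictConvexOn ℝ Set.univ softplus := by
  refine StrictMono.strictConvexOn_univ_of_deriv
    (continuous_iff_continuousAt.2 fun t => (hasDerivAt_softplus t).continuousAt) ?_
  rw [show deriv softplus = sigmoid from funext fun t => (hasDerivAt_softplus t).deriv]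
  exact sigmoid_strictMono

lemma mul_exp_eq_exp_add_log {ρ : ℝ} (hρ : 0 < ρ) (t : ℝ) : ρ * exp t = exp (t + log ρ) := by
  rw [exp_add, exp_log hρ, mul_comm]

lemma log_one_add_mul_exp {ρ : ℝ} (hρ : 0 < ρ) (t : ℝ) :
    log (1 + ρ * exp t) = softplus (t + log ρ) := by
  rw [mul_exp_eq_exp_add_log hρ, softplus]

lemma sigmoidDeriv_add_le (t y : ℝ) : sigmoidDeriv (t + y) ≤ exp |y| * sigmoidDeriv t := by
  rw [sigmoidDeriv_eq, sigmoidDeriv_eq, exp_add, mul_div_assoc',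
    div_le_div_iff₀ (by positivity) (by positivity)]
  have ha := exp_pos t
  have hb := exp_pos y
  rcases le_total 0 y with hy | hy
  · have h1 : (1 + exp t) ^ 2 ≤ (1 + exp t * exp y) ^ 2 := by
      gcongr; nlinarith [one_le_exp hy]
    rw [abs_of_nonneg hy]
    linarith [mul_le_mul_of_nonneg_left h1 (mul_pos ha hb).le]
  · have h1 : (exp y * (1 + exp t)) ^ 2 ≤ (1 + exp t * exp y) ^ 2 := by
      gcongr; nlinarith [exp_le_one_iff.2 hy]
    rw [abs_of_nonpos hy, exp_neg]
    calc exp t * exp y * (1 + exp t) ^ 2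
        = (exp y)⁻¹ * exp t * (exp y * (1 + exp t)) ^ 2 := by field_simp
      _ ≤ (exp y)⁻¹ * exp t * (1 + exp t * exp y) ^ 2 := by gcongr

lemma abs_sigmoidDeriv_add_sub_le (t y : ℝ) :
    |sigmoidDeriv (t + y) - sigmoidDeriv t| ≤ (exp |y| - 1) * sigmoidDeriv t := by
  have hupper := sigmoidDeriv_add_le t y
  have hback := sigmoidDeriv_add_le (t + y) (-y)
  rw [add_neg_cancel_right, abs_neg] at hback
  have hexp : 1 ≤ exp |y| := one_le_exp (abs_nonneg y)
  rw [abs_le]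
  constructor
  · nlinarith [sigmoidDeriv_pos t, sigmoidDeriv_pos (t + y)]
  · linarith

section TaylorEstimates

variable {g g' g'' : ℝ → ℝ} {t v m M : ℝ}

lemma abs_add_sub_sub_mul_le (hg : ∀ x, HasDerivAt g (g' x) x)
    (hM : ∀ w, |w| ≤ |v| → |g' (t + w) - m| ≤ M) :
    |g (t + v) - g t - m * v| ≤ M * |v| := by
  have hder : ∀ y, HasDerivAt (fun y => g (t + y) - m * y) (g' (t + y) - m) y := fun y =>
    (((hg (t + y)).comp_const_add t y).sub ((hasDerivAt_id y).const_mul m)).congr_deriv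
      (by simp)
  have hmvt := (convex_uIcc 0 v).norm_image_sub_le_of_norm_hasDerivWithin_le
    (fun y _ => (hder y).hasDerivWithinAt)
    (fun y hy => hM y (by simpa using Set.abs_sub_left_of_mem_uIcc hy))
    Set.left_mem_uIcc Set.right_mem_uIcc
  simpa [sub_right_comm] using hmvt

lemma abs_taylor_remainder_two_le (hg : ∀ x, HasDerivAt g (g' x) x)
    (hg' : ∀ x, HasDerivAt g' (g'' x) x) (hM : ∀ w, |w| ≤ |v| → |g'' (t + w) - m| ≤ M) :
    |g (t + v) - g t - g' t * v - m * v ^ 2 / 2| ≤ M * v ^ 2 := by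
  have hM0 : 0 ≤ M := (abs_nonneg _).trans (hM 0 (by simp))
  have hder : ∀ x, HasDerivAt (fun x => g x - m * (x - t) ^ 2 / 2) (g' x - m * (x - t)) x :=
    fun x => by
      have hsq := ((((hasDerivAt_id x).sub_const t).pow 2).const_mul m).div_const 2
      exact ((hg x).sub hsq).congr_deriv (by simp; ring)
  have hfirst : ∀ w, |w| ≤ |v| → |g' (t + w) - m * (t + w - t) - g' t| ≤ M * |v| := by
    intro w hw
    have := abs_add_sub_sub_mul_le hg' fun w' hw' => hM w' (hw'.trans hw)
    calc |g' (t + w) - m * (t + w - t) - g' t| = |g' (t + w) - g' t - m * w| := by ring_nf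
      _ ≤ M * |v| := this.trans (by gcongr)
  have := abs_add_sub_sub_mul_le hder hfirst
  rw [mul_assoc, ← sq, sq_abs] at this
  convert this using 2
  ring

end TaylorEstimates

lemma abs_sigmoid_add_sub_le (t y : ℝ) :
    |sigmoid (t + y) - sigmoid t| ≤ |y| * exp |y| * sigmoidDeriv t := by
  have hbound : ∀ w, |w| ≤ |y| → |sigmoidDeriv (t + w) - 0| ≤ exp |y| * sigmoidDeriv t := by
    intro w hw
    rw [sub_zero, abs_of_pos (sigmoidDeriv_pos _)]
    refine (sigmoidDeriv_add_le t w).trans ?_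
    gcongr
    exact (sigmoidDeriv_pos t).le
  have := abs_add_sub_sub_mul_le hasDerivAt_sigmoid hbound
  rw [zero_mul, sub_zero] at this
  linarith

/-! ### Maximizers of concave functions close to a quadratic -/

section Argmax

variable {E : Type*} [NormedAddCommGroup E]

section Sphere

variable [NormedSpace ℝ E] {f : E → ℝ} {a u : E} {ε : ℝ}

lemma lt_of_concaveOn_of_lt_on_sphere (hf : ConcaveOn ℝ Set.univ f) (hε : 0 < ε)
    (hlt : ∀ u, ‖u - a‖ = ε → f u < f a) (hu : ε ≤ ‖u - a‖) : f u < f a := by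
  have hpos : 0 < ‖u - a‖ := hε.trans_le hu
  set t := ε / ‖u - a‖
  have ht0 : 0 < t := by positivity
  have ht1 : t ≤ 1 := (div_le_one hpos).2 hu
  have hsphere : ‖(1 - t) • a + t • u - a‖ = ε := by
    rw [show (1 - t) • a + t • u - a = t • (u - a) by module, norm_smul,
      Real.norm_of_nonneg ht0.le, div_mul_cancel₀ _ hpos.ne']
  have hchord := (hf.2 (Set.mem_univ a) (Set.mem_univ u) (sub_nonneg.2 ht1) ht0.le
    (by ring)).trans_lt (hlt _ hsphere)
  simp only [smul_eq_mul] at hchord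
  exact lt_of_mul_lt_mul_left (by linarith : t * f u < t * f a) ht0.le

lemma norm_sub_lt_of_isMaxOn (hf : ConcaveOn ℝ Set.univ f) (hε : 0 < ε)
    (hlt : ∀ u, ‖u - a‖ = ε → f u < f a) (hu : IsMaxOn f Set.univ u) : ‖u - a‖ < ε := by
  by_contra! hout
  exact (lt_of_concaveOn_of_lt_on_sphere hf hε hlt hout).not_ge (hu (Set.mem_univ a))

lemma exists_isMaxOn_of_lt_on_sphere [FiniteDimensional ℝ E] (hf : ConcaveOn ℝ Set.univ f)
    (hε : 0 < ε) (hlt : ∀ u, ‖u - a‖ = ε → f u < f a) : ∃ u, IsMaxOn f Set.univ u := by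
  obtain ⟨u, -, hu⟩ := (isCompact_closedBall a ε).exists_isMaxOn
    ⟨a, Metric.mem_closedBall_self hε.le⟩
    ((hf.continuousOn isOpen_univ).mono (Set.subset_univ _))
  refine ⟨u, fun v _ => ?_⟩
  rcases le_or_gt ‖v - a‖ ε with hv | hv
  · exact hu (mem_closedBall_iff_norm.2 hv)
  · exact (lt_of_concaveOn_of_lt_on_sphere hf hε hlt hv.le).le.trans
      (hu (Metric.mem_closedBall_self hε.le))

end Sphere

variable [InnerProductSpace ℝ E]

/-- The quadratic function with Hessian `-T` that vanishes at `0` and has its critical point at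
`a`: the local model of a log-likelihood with information `T`. -/
def quadModel (T : E →L[ℝ] E) (a u : E) : ℝ := ⟪u, T a⟫_ℝ - ⟪u, T u⟫_ℝ / 2

variable {T : E →L[ℝ] E} {κ : ℝ}

lemma quadModel_self_sub (hT : (T : E →ₗ[ℝ] E).IsSymmetric) (a u : E) :
    quadModel T a a - quadModel T a u = ⟪u - a, T (u - a)⟫_ℝ / 2 := by
  have hsymm : ⟪a, T u⟫_ℝ = ⟪u, T a⟫_ℝ := by
    rw [real_inner_comm, ← ContinuousLinearMap.coe_coe, hT u a, ContinuousLinearMap.coe_coe]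
  simp only [quadModel, map_sub, inner_sub_left, inner_sub_right, hsymm]
  ring

lemma lt_of_abs_sub_quadModel_le (hT : (T : E →ₗ[ℝ] E).IsSymmetric)
    (hκ : ∀ v, κ * ‖v‖ ^ 2 ≤ ⟪v, T v⟫_ℝ) {f : E → ℝ} {a u : E} {ε η R : ℝ}
    (hη : 4 * η < κ * ε ^ 2) (hR : ‖a‖ + ε ≤ R) (hε : 0 ≤ ε)
    (hf : ∀ u, ‖u‖ ≤ R → |f u - f 0 - quadModel T a u| ≤ η) (hu : ‖u - a‖ = ε) : f u < f a := by
  have huR : ‖u‖ ≤ R := by linarith [norm_le_norm_add_norm_sub' u a]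
  have hcurv := hκ (u - a)
  rw [hu] at hcurv
  linarith [(abs_le.1 (hf u huR)).2, (abs_le.1 (hf a (by linarith))).1, quadModel_self_sub hT a u]

end Argmax

/-! ### Events of probability tending to one -/

section HighProbability

variable {Ω : Type*} [MeasurableSpace Ω] {P : Measure Ω} {p p' : ℕ → Ω → Prop}

/-- The event `p k` holds with probability tending to one as `k → ∞`. It is stated for the outer
measure of the complement, as the events need not be measurable. -/
def WithHighProb (P : Measure Ω) (p : ℕ → Ω → Prop) : Prop :=
  Tendsto (fun k => P {ω | ¬ p k ω}) atTop (𝓝 0)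

lemma WithHighProb.mono (hp : WithHighProb P p) (himp : ∀ᶠ k in atTop, ∀ ω, p k ω → p' k ω) :
    WithHighProb P p' :=
  tendsto_of_tendsto_of_tendsto_of_le_of_le' tendsto_const_nhds hp
    (Eventually.of_forall fun _ => zero_le)
    (himp.mono fun _ hk => measure_mono fun ω hω => mt (hk ω) hω)

lemma WithHighProb.and (hp : WithHighProb P p) (hp' : WithHighProb P p') :
    WithHighProb P fun k ω => p k ω ∧ p' k ω :=
  tendsto_of_tendsto_of_tendsto_of_le_of_le tendsto_const_nhds
    (add_zero (0 : ENNReal) ▸ Tendsto.add hp hp') (fun _ => zero_le) fun _ =>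
      (measure_mono fun _ hω => not_and_or.1 hω).trans (measure_union_le _ _)

lemma withHighProb_of_forall_le (hp : ∀ c > 0, ∃ B : ℕ → Ω → Prop,
    (∀ k, P {ω | ¬ B k ω} ≤ c) ∧ WithHighProb P fun k ω => B k ω → p k ω) :
    WithHighProb P p := by
  refine ENNReal.tendsto_nhds_zero.2 fun c hc => ?_
  obtain ⟨B, hB, himp⟩ := hp (c / 2) (ENNReal.half_pos hc.ne')
  filter_upwards [ENNReal.tendsto_nhds_zero.1 himp (c / 2) (ENNReal.half_pos hc.ne')] with k hk
  calc P {ω | ¬ p k ω} ≤ P ({ω | ¬ B k ω} ∪ {ω | ¬ (B k ω → p k ω)}) :=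
        measure_mono fun ω hω => by
          by_cases hBω : B k ω
          · exact Or.inr fun himp => hω (himp hBω)
          · exact Or.inl hBω
    _ ≤ c / 2 + c / 2 := (measure_union_le _ _).trans (add_le_add (hB k) hk)
    _ = c := ENNReal.add_halves c

variable {E : Type*} [NormedAddCommGroup E] {A : ℕ → Ω → E} {B : Ω → E}

lemma tendstoInMeasure_iff_withHighProb :
    TendstoInMeasure P A atTop B ↔ ∀ ε > 0, WithHighProb P fun k ω => ‖A k ω - B ω‖ < ε := by
  simp only [tendstoInMeasure_iff_norm, WithHighProb, not_lt]

/-- The basic argmax theorem for concave processes: concavity makes a locally uniform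
approximation enough, since a function that falls on a sphere around `A k ω` keeps falling. -/
theorem WithHighProb.existsUnique_isMaxOn [InnerProductSpace ℝ E] [FiniteDimensional ℝ E]
    {F : ℕ → Ω → E → ℝ} {T : E →L[ℝ] E} {κ : ℝ} (hT : (T : E →ₗ[ℝ] E).IsSymmetric)
    (hκ : 0 < κ) (hTκ : ∀ v, κ * ‖v‖ ^ 2 ≤ ⟪v, T v⟫_ℝ)
    (hconc : WithHighProb P fun k ω => StrictConcaveOn ℝ Set.univ (F k ω))
    (hquad : ∀ R η : ℝ, 0 < η → WithHighProb P fun k ω =>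
      ∀ u, ‖u‖ ≤ R → |F k ω u - F k ω 0 - quadModel T (A k ω) u| ≤ η)
    (htight : ∀ c > 0, ∃ M : ℝ, ∀ k, P {ω | ¬ ‖A k ω‖ ≤ M} ≤ c) {ε : ℝ} (hε : 0 < ε) :
    WithHighProb P fun k ω => (∃! u, IsMaxOn (F k ω) Set.univ u) ∧
      ∀ u, IsMaxOn (F k ω) Set.univ u → ‖u - A k ω‖ < ε := by
  refine withHighProb_of_forall_le fun c hc => ?_
  obtain ⟨M, hM⟩ := htight c hc
  refine ⟨_, hM, ((hquad (M + ε) (κ * ε ^ 2 / 8) (by positivity)).and hconc).mono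
    (Eventually.of_forall fun k ω ⟨happrox, hstrict⟩ hAM => ?_)⟩
  have hη : 4 * (κ * ε ^ 2 / 8) < κ * ε ^ 2 := by linarith [mul_pos hκ (pow_pos hε 2)]
  have hsphere : ∀ u, ‖u - A k ω‖ = ε → F k ω u < F k ω (A k ω) := fun u =>
    lt_of_abs_sub_quadModel_le hT hTκ hη (by gcongr) hε.le happrox
  obtain ⟨u, hu⟩ := exists_isMaxOn_of_lt_on_sphere hstrict.concaveOn hε hsphere
  exact ⟨⟨u, hu, fun v hv => hstrict.eq_of_isMaxOn hv hu (Set.mem_univ _) (Set.mem_univ _)⟩,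
    fun v hv => norm_sub_lt_of_isMaxOn hstrict.concaveOn hε hsphere hv⟩

end HighProbability

/-! ### Expansion of the log-likelihood -/

section Sample

variable {𝒳 M M' : Type*} {m₁ m₂ : ℕ} {x₁ x₂ : ℕ → 𝒳}

/-- The sum of `f₁` over the first sample plus the sum of `f₂` over the second sample. -/
def sampleSum [AddCommMonoid M] (f₁ f₂ : 𝒳 → M) (m₁ m₂ : ℕ) (x₁ x₂ : ℕ → 𝒳) : M :=
  ∑ j ∈ Finset.range m₁, f₁ (x₁ j) + ∑ j ∈ Finset.range m₂, f₂ (x₂ j)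

lemma sampleSum_add [AddCommMonoid M] (f₁ f₂ g₁ g₂ : 𝒳 → M) :
    sampleSum (fun x => f₁ x + g₁ x) (fun x => f₂ x + g₂ x) m₁ m₂ x₁ x₂ =
      sampleSum f₁ f₂ m₁ m₂ x₁ x₂ + sampleSum g₁ g₂ m₁ m₂ x₁ x₂ := by
  simp only [sampleSum, Finset.sum_add_distrib]
  abel

lemma sampleSum_sub [AddCommGroup M] (f₁ f₂ g₁ g₂ : 𝒳 → M) :
    sampleSum (fun x => f₁ x - g₁ x) (fun x => f₂ x - g₂ x) m₁ m₂ x₁ x₂ =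
      sampleSum f₁ f₂ m₁ m₂ x₁ x₂ - sampleSum g₁ g₂ m₁ m₂ x₁ x₂ := by
  simp only [sampleSum, Finset.sum_sub_distrib]
  abel

lemma map_sampleSum [AddCommMonoid M] [AddCommMonoid M'] {F : Type*} [FunLike F M M']
    [AddMonoidHomClass F M M'] (L : F) (f₁ f₂ : 𝒳 → M) :
    L (sampleSum f₁ f₂ m₁ m₂ x₁ x₂) =
      sampleSum (fun x => L (f₁ x)) (fun x => L (f₂ x)) m₁ m₂ x₁ x₂ := by
  simp only [sampleSum, map_add, map_sum]

lemma norm_sampleSum_le [SeminormedAddCommGroup M] {f₁ f₂ : 𝒳 → M} {g₁ g₂ : 𝒳 → ℝ}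
    (h₁ : ∀ x, ‖f₁ x‖ ≤ g₁ x) (h₂ : ∀ x, ‖f₂ x‖ ≤ g₂ x) :
    ‖sampleSum f₁ f₂ m₁ m₂ x₁ x₂‖ ≤ sampleSum g₁ g₂ m₁ m₂ x₁ x₂ :=
  (norm_add_le _ _).trans
    (add_le_add (norm_sum_le_of_le _ fun _ _ => h₁ _) (norm_sum_le_of_le _ fun _ _ => h₂ _))

/-- The average over the pooled sample of the values of `f₁` on the first sample and of `f₂` on
the second sample. -/
def sampleMean [AddCommGroup M] [Module ℝ M] (f₁ f₂ : 𝒳 → M) (m₁ m₂ : ℕ) (x₁ x₂ : ℕ → 𝒳) : M :=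
  ((m₁ + m₂ : ℕ) : ℝ)⁻¹ • sampleSum f₁ f₂ m₁ m₂ x₁ x₂

/-- The factor `n ^ (-1/2)`, where `n = m₁ + m₂` is the size of the pooled sample. -/
def localScale (m₁ m₂ : ℕ) : ℝ := (√((m₁ + m₂ : ℕ) : ℝ))⁻¹

lemma localScale_sq (m₁ m₂ : ℕ) : localScale m₁ m₂ ^ 2 = ((m₁ + m₂ : ℕ) : ℝ)⁻¹ := by
  rw [localScale, inv_pow, sq_sqrt (Nat.cast_nonneg _)]

lemma localScale_nonneg (m₁ m₂ : ℕ) : 0 ≤ localScale m₁ m₂ := by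
  unfold localScale
  positivity

lemma localScale_pos (h₁ : 0 < m₁) : 0 < localScale m₁ m₂ := by
  unfold localScale
  positivity

end Sample

section Expansion

variable {𝒳 : Type*} {d : ℕ} (h : 𝒳 → Fin d → ℝ)

lemma linPred_eq_inner (θ : Param d) (x : 𝒳) : linPred h θ x = ⟪θ, design h x⟫_ℝ := by
  rw [linPred, PiLp.inner_apply, Fin.sum_univ_succ]
  simp [design, mul_comm]

lemma linPred_add (θ w : Param d) (x : 𝒳) :
    linPred h (θ + w) x = linPred h θ x + ⟪w, design h x⟫_ℝ := by
  rw [linPred_eq_inner, linPred_eq_inner, inner_add_left]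

lemma one_le_norm_design (x : 𝒳) : 1 ≤ ‖design h x‖ := by
  simpa [design] using PiLp.norm_apply_le (design h x) 0

/-- The contribution to the log-likelihood of an observation `x` with label `y`, where `y = 1` in
the first sample and `y = 0` in the second. Up to a constant it is the log-likelihood of a
logistic regression of `y` on `x` with intercept `α + γ`. -/
def obsLogLik (γ y : ℝ) (θ : Param d) (x : 𝒳) : ℝ :=
  y * linPred h θ x - softplus (linPred h θ x + γ)

/-- The gradient in `θ` of `obsLogLik`. -/
def obsScore (γ y : ℝ) (θ : Param d) (x : 𝒳) : Param d :=
  (y - sigmoid (linPred h θ x + γ)) • design h x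

/-- The operator `z z'` on the parameter space, where `z = z(x)`. -/
def designOuter (x : 𝒳) : Param d →L[ℝ] Param d :=
  InnerProductSpace.rankOne ℝ (design h x) (design h x)

/-- The negative Hessian in `θ` of `obsLogLik`. -/
def obsInfo (γ : ℝ) (θ : Param d) (x : 𝒳) : Param d →L[ℝ] Param d :=
  sigmoidDeriv (linPred h θ x + γ) • designOuter h x

/-- The gradient of the empirical log-likelihood, with the ratio `m₁ / m₂` replaced by `exp γ`. -/
def score (γ : ℝ) (θ : Param d) (m₁ m₂ : ℕ) (x₁ x₂ : ℕ → 𝒳) : Param d :=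
  sampleSum (obsScore h γ 1 θ) (obsScore h γ 0 θ) m₁ m₂ x₁ x₂

/-- A bound for the variation of the information of one observation over a ball of radius `δ`.
The first term of the minimum gives convergence to `0` as `δ → 0`, the second one
integrability. -/
def infoModulus (K : 𝒳 → ℝ) (δ : ℝ) (x : 𝒳) : ℝ := min (exp (δ * ‖design h x‖) - 1) 2 * K x

lemma empLogLik_eq_sampleSum {m₁ m₂ : ℕ} (h₁ : 0 < m₁) (h₂ : 0 < m₂) (x₁ x₂ : ℕ → 𝒳)
    (θ : Param d) :
    empLogLik h m₁ m₂ x₁ x₂ θ =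
      sampleSum (obsLogLik h (log (m₁ / m₂)) 1 θ) (obsLogLik h (log (m₁ / m₂)) 0 θ)
        m₁ m₂ x₁ x₂ := by
  have hρ : (0 : ℝ) < (m₁ : ℝ) / m₂ := by positivity
  simp only [empLogLik, sampleSum, obsLogLik, log_one_add_mul_exp hρ, Finset.sum_sub_distrib,
    one_mul, zero_mul, Finset.sum_const_zero]
  ring

lemma designOuter_apply (x : 𝒳) (w : Param d) :
    designOuter h x w = ⟪design h x, w⟫_ℝ • design h x :=
  InnerProductSpace.rankOne_apply _ _ _

lemma designOuter_single_zero (x : 𝒳) :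
    designOuter h x (EuclideanSpace.single 0 1) = design h x := by
  simp [designOuter_apply, EuclideanSpace.inner_single_right, design]

lemma norm_designOuter (x : 𝒳) : ‖designOuter h x‖ = ‖design h x‖ ^ 2 := by
  rw [designOuter, InnerProductSpace.norm_rankOne, sq]

lemma norm_obsInfo (γ : ℝ) (θ : Param d) (x : 𝒳) :
    ‖obsInfo h γ θ x‖ = sigmoidDeriv (linPred h θ x + γ) * ‖design h x‖ ^ 2 := by
  rw [obsInfo, norm_smul, norm_designOuter, Real.norm_of_nonneg (sigmoidDeriv_pos _).le]

lemma norm_obsInfo_sub (γ γ' : ℝ) (θ : Param d) (x : 𝒳) :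
    ‖obsInfo h γ θ x - obsInfo h γ' θ x‖ =
      |sigmoidDeriv (linPred h θ x + γ) - sigmoidDeriv (linPred h θ x + γ')|
        * ‖design h x‖ ^ 2 := by
  have hsub : obsInfo h γ θ x - obsInfo h γ' θ x =
      (sigmoidDeriv (linPred h θ x + γ) - sigmoidDeriv (linPred h θ x + γ')) • designOuter h x :=
    (sub_smul _ _ _).symm
  rw [hsub, norm_smul, norm_designOuter, Real.norm_eq_abs]

lemma norm_obsScore_sub_sq_le (γ c y : ℝ) (θ : Param d) (x : 𝒳) :
    ‖obsScore h γ y θ x - obsScore h c y θ x‖ ^ 2 ≤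
      (|γ - c| * exp |γ - c|) ^ 2 * ‖obsInfo h c θ x‖ := by
  have hsigmoid := abs_sigmoid_add_sub_le (linPred h θ x + c) (γ - c)
  rw [add_assoc, add_sub_cancel] at hsigmoid
  have hpos := sigmoidDeriv_pos (linPred h θ x + c)
  have hle : sigmoidDeriv (linPred h θ x + c) ^ 2 ≤ sigmoidDeriv (linPred h θ x + c) :=
    pow_le_of_le_one hpos.le (sigmoidDeriv_le_one _) two_ne_zero
  calc ‖obsScore h γ y θ x - obsScore h c y θ x‖ ^ 2
      = |sigmoid (linPred h θ x + γ) - sigmoid (linPred h θ x + c)| ^ 2 * ‖design h x‖ ^ 2 := by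
        rw [obsScore, obsScore, ← sub_smul, sub_sub_sub_cancel_left, norm_smul, mul_pow,
          norm_eq_abs, abs_sub_comm]
    _ ≤ (|γ - c| * exp |γ - c| * sigmoidDeriv (linPred h θ x + c)) ^ 2 * ‖design h x‖ ^ 2 := by
        gcongr
    _ ≤ (|γ - c| * exp |γ - c|) ^ 2 * ‖obsInfo h c θ x‖ := by
        rw [norm_obsInfo, mul_pow, mul_assoc]
        gcongr

lemma inner_obsInfo (γ : ℝ) (θ w : Param d) (x : 𝒳) :
    ⟪w, obsInfo h γ θ x w⟫_ℝ = sigmoidDeriv (linPred h θ x + γ) * ⟪w, design h x⟫_ℝ ^ 2 := by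
  simp only [obsInfo, smul_apply, designOuter_apply, inner_smul_right, real_inner_comm w]
  ring

variable {h} {θ₀ : Param d} {c r : ℝ} {K : 𝒳 → ℝ}

lemma obsInfo_add (y : ℝ) (θ : Param d) (x : 𝒳) :
    obsInfo h (c + y) θ x = obsInfo h c (θ + (y / ‖design h x‖ ^ 2) • design h x) x := by
  have hz := one_le_norm_design h x
  rw [obsInfo, obsInfo, linPred_add, real_inner_smul_left, real_inner_self_eq_norm_sq,
    div_mul_cancel₀ _ (by positivity), add_right_comm, add_assoc]

lemma norm_obsInfo_add_sub_le (hK : ∀ θ ∈ Metric.ball θ₀ r, ∀ x, ‖obsInfo h c θ x‖ ≤ K x)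
    {δ y : ℝ} (hδ : δ < r) (hδ0 : 0 ≤ δ) {x : 𝒳} (hy : |y| ≤ δ * ‖design h x‖) :
    ‖obsInfo h (c + y) θ₀ x - obsInfo h c θ₀ x‖ ≤ infoModulus h K δ x := by
  have hz := one_le_norm_design h x
  have hK₀ : ‖obsInfo h c θ₀ x‖ ≤ K x := hK θ₀ (Metric.mem_ball_self (hδ0.trans_lt hδ)) x
  have hKnonneg : 0 ≤ K x := (norm_nonneg _).trans hK₀
  rw [infoModulus, min_mul_of_nonneg _ _ hKnonneg]
  refine le_min ?_ ?_
  · calc ‖obsInfo h (c + y) θ₀ x - obsInfo h c θ₀ x‖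
        = |sigmoidDeriv (linPred h θ₀ x + c + y) - sigmoidDeriv (linPred h θ₀ x + c)|
            * ‖design h x‖ ^ 2 := by
          rw [norm_obsInfo_sub, add_assoc]
      _ ≤ (exp |y| - 1) * sigmoidDeriv (linPred h θ₀ x + c) * ‖design h x‖ ^ 2 := by
          gcongr
          exact abs_sigmoidDeriv_add_sub_le _ y
      _ = (exp |y| - 1) * ‖obsInfo h c θ₀ x‖ := by rw [norm_obsInfo, mul_assoc]
      _ ≤ (exp (δ * ‖design h x‖) - 1) * K x := by
          have hexp := one_le_exp (hy.trans' (abs_nonneg y))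
          gcongr
  · have hmem : θ₀ + (y / ‖design h x‖ ^ 2) • design h x ∈ Metric.ball θ₀ r := by
      have hnorm : |y / ‖design h x‖ ^ 2| * ‖design h x‖ = |y| / ‖design h x‖ := by
        rw [abs_div, abs_of_nonneg (sq_nonneg ‖design h x‖)]
        field_simp
      rw [mem_ball_iff_norm, add_sub_cancel_left, norm_smul, Real.norm_eq_abs, hnorm]
      exact ((div_le_iff₀ (by positivity)).2 hy).trans_lt hδ
    rw [obsInfo_add]
    linarith [norm_sub_le (obsInfo h c (θ₀ + (y / ‖design h x‖ ^ 2) • design h x) x)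
      (obsInfo h c θ₀ x), hK _ hmem x]

lemma abs_sigmoidDeriv_sub_mul_sq_le (hK : ∀ θ ∈ Metric.ball θ₀ r, ∀ x, ‖obsInfo h c θ x‖ ≤ K x)
    {δ γ a v : ℝ} (hδ : δ < r) (ha : |γ - c| + a ≤ δ) (ha0 : 0 ≤ a) {x : 𝒳}
    (hv : |v| ≤ a * ‖design h x‖) :
    |sigmoidDeriv (linPred h θ₀ x + γ + v) - sigmoidDeriv (linPred h θ₀ x + c)|
      * ‖design h x‖ ^ 2 ≤ infoModulus h K δ x := by
  have hshift : |γ - c + v| ≤ δ * ‖design h x‖ :=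
    calc |γ - c + v| ≤ |γ - c| * ‖design h x‖ + a * ‖design h x‖ :=
          (abs_add_le _ _).trans
            (add_le_add (le_mul_of_one_le_right (abs_nonneg _) (one_le_norm_design h x)) hv)
      _ ≤ δ * ‖design h x‖ := by rw [← add_mul]; gcongr
  rw [show linPred h θ₀ x + γ + v = linPred h θ₀ x + (c + (γ - c + v)) by ring,
    ← norm_obsInfo_sub]
  exact norm_obsInfo_add_sub_le hK hδ (le_trans (by positivity) ha) hshift

lemma abs_obsLogLik_expansion_le (hK : ∀ θ ∈ Metric.ball θ₀ r, ∀ x, ‖obsInfo h c θ x‖ ≤ K x)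
    {δ γ : ℝ} (hδ : δ < r) {w : Param d} (hw : |γ - c| + ‖w‖ ≤ δ) (y : ℝ) (x : 𝒳) :
    |obsLogLik h γ y (θ₀ + w) x - obsLogLik h γ y θ₀ x - ⟪w, obsScore h γ y θ₀ x⟫_ℝ
      + ⟪w, obsInfo h c θ₀ x w⟫_ℝ / 2| ≤ infoModulus h K δ x * ‖w‖ ^ 2 := by
  have hz := one_le_norm_design h x
  have hinner : |⟪w, design h x⟫_ℝ| ≤ ‖w‖ * ‖design h x‖ := abs_real_inner_le_norm _ _
  have hderiv : ∀ v, |v| ≤ |⟪w, design h x⟫_ℝ| →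
      |sigmoidDeriv (linPred h θ₀ x + γ + v) - sigmoidDeriv (linPred h θ₀ x + c)|
        ≤ infoModulus h K δ x / ‖design h x‖ ^ 2 := fun v hv =>
    (le_div_iff₀ (by positivity)).2
      (abs_sigmoidDeriv_sub_mul_sq_le hK hδ hw (norm_nonneg w) (hv.trans hinner))
  have hmodulus : 0 ≤ infoModulus h K δ x / ‖design h x‖ ^ 2 :=
    (abs_nonneg _).trans (hderiv 0 (by simp))
  calc |obsLogLik h γ y (θ₀ + w) x - obsLogLik h γ y θ₀ x - ⟪w, obsScore h γ y θ₀ x⟫_ℝ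
        + ⟪w, obsInfo h c θ₀ x w⟫_ℝ / 2|
      = |softplus (linPred h θ₀ x + γ + ⟪w, design h x⟫_ℝ) - softplus (linPred h θ₀ x + γ)
          - sigmoid (linPred h θ₀ x + γ) * ⟪w, design h x⟫_ℝ
          - sigmoidDeriv (linPred h θ₀ x + c) * ⟪w, design h x⟫_ℝ ^ 2 / 2| := by
        rw [← abs_neg, inner_obsInfo, obsScore, inner_smul_right, obsLogLik, obsLogLik,
          linPred_add, add_right_comm]
        ring_nf
    _ ≤ infoModulus h K δ x / ‖design h x‖ ^ 2 * ⟪w, design h x⟫_ℝ ^ 2 :=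
        abs_taylor_remainder_two_le hasDerivAt_softplus hasDerivAt_sigmoid hderiv
    _ ≤ infoModulus h K δ x / ‖design h x‖ ^ 2 * (‖w‖ * ‖design h x‖) ^ 2 := by
        gcongr ?_ * ?_
        exact sq_le_sq' (abs_le.1 hinner).1 (abs_le.1 hinner).2
    _ = infoModulus h K δ x * ‖w‖ ^ 2 := by field_simp

lemma abs_empLogLik_expansion_le (hK : ∀ θ ∈ Metric.ball θ₀ r, ∀ x, ‖obsInfo h c θ x‖ ≤ K x)
    {m₁ m₂ : ℕ} (h₁ : 0 < m₁) (h₂ : 0 < m₂) (x₁ x₂ : ℕ → 𝒳) {δ : ℝ} (hδ : δ < r) {w : Param d}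
    (hw : |log (m₁ / m₂) - c| + ‖w‖ ≤ δ) :
    |empLogLik h m₁ m₂ x₁ x₂ (θ₀ + w) - empLogLik h m₁ m₂ x₁ x₂ θ₀
      - ⟪w, score h (log (m₁ / m₂)) θ₀ m₁ m₂ x₁ x₂⟫_ℝ
      + ⟪w, sampleSum (obsInfo h c θ₀) (obsInfo h c θ₀) m₁ m₂ x₁ x₂ w⟫_ℝ / 2|
      ≤ sampleSum (infoModulus h K δ) (infoModulus h K δ) m₁ m₂ x₁ x₂ * ‖w‖ ^ 2 := by
  set γ := log (m₁ / m₂)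
  set e : ℝ → 𝒳 → ℝ := fun y x =>
    obsLogLik h γ y (θ₀ + w) x - obsLogLik h γ y θ₀ x - innerSL ℝ w (obsScore h γ y θ₀ x)
      + ⟪w, obsInfo h c θ₀ x w⟫_ℝ / 2 with he
  have hinfo : sampleSum (fun x => ⟪w, obsInfo h c θ₀ x w⟫_ℝ / 2)
      (fun x => ⟪w, obsInfo h c θ₀ x w⟫_ℝ / 2) m₁ m₂ x₁ x₂ =
        ⟪w, sampleSum (obsInfo h c θ₀) (obsInfo h c θ₀) m₁ m₂ x₁ x₂ w⟫_ℝ / 2 := by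
    simp only [sampleSum, add_apply, sum_apply,
      inner_add_right, inner_sum, add_div, Finset.sum_div]
  have hsum : sampleSum (e 1) (e 0) m₁ m₂ x₁ x₂ =
      empLogLik h m₁ m₂ x₁ x₂ (θ₀ + w) - empLogLik h m₁ m₂ x₁ x₂ θ₀
        - ⟪w, score h γ θ₀ m₁ m₂ x₁ x₂⟫_ℝ
        + ⟪w, sampleSum (obsInfo h c θ₀) (obsInfo h c θ₀) m₁ m₂ x₁ x₂ w⟫_ℝ / 2 := by
    simp only [he]
    rw [sampleSum_add, sampleSum_sub, sampleSum_sub, ← map_sampleSum, hinfo,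
      empLogLik_eq_sampleSum h h₁ h₂, empLogLik_eq_sampleSum h h₁ h₂]
    rfl
  rw [← hsum, ← Real.norm_eq_abs]
  refine (norm_sampleSum_le (fun x => abs_obsLogLik_expansion_le hK hδ hw 1 x)
    (fun x => abs_obsLogLik_expansion_le hK hδ hw 0 x)).trans_eq ?_
  simp only [sampleSum, add_mul, Finset.sum_mul]

end Expansion

/-! ### Concavity and the penalty -/

section Concavity

lemma strictConcaveOn_sum_comp_of_separating {E ι : Type*} [AddCommGroup E] [Module ℝ E]
    {s : Finset ι} {φ : ι → ℝ → ℝ} {ℓ : ι → E →ₗ[ℝ] ℝ}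
    (hφ : ∀ i, StrictConcaveOn ℝ Set.univ (φ i)) (hsep : ∀ w, (∀ i ∈ s, ℓ i w = 0) → w = 0) :
    StrictConcaveOn ℝ Set.univ fun θ => ∑ i ∈ s, φ i (ℓ i θ) := by
  refine ⟨convex_univ, fun u _ v _ huv a b ha hb hab => ?_⟩
  obtain ⟨i, hi, hne⟩ : ∃ i ∈ s, ℓ i u ≠ ℓ i v := by
    by_contra! heq
    exact huv (sub_eq_zero.1 (hsep _ fun i hi => by rw [map_sub, heq i hi, sub_self]))
  simp only [smul_eq_mul, Finset.mul_sum, ← Finset.sum_add_distrib, map_add, map_smul]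
  exact Finset.sum_lt_sum
    (fun j _ => (hφ j).concaveOn.2 (Set.mem_univ _) (Set.mem_univ _) ha.le hb.le hab)
    ⟨i, hi, (hφ i).2 (Set.mem_univ _) (Set.mem_univ _) hne ha hb hab⟩

lemma strictConcaveOn_comp_add_smul {E : Type*} [AddCommGroup E] [Module ℝ E] {f : E → ℝ}
    (hf : StrictConcaveOn ℝ Set.univ f) (θ : E) {s : ℝ} (hs : s ≠ 0) :
    StrictConcaveOn ℝ Set.univ fun u => f (θ + s • u) := by
  refine ⟨convex_univ, fun u _ v _ huv a b ha hb hab => ?_⟩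
  have hcomb : θ + s • (a • u + b • v) = a • (θ + s • u) + b • (θ + s • v) :=
    calc θ + s • (a • u + b • v) = (a + b) • θ + s • (a • u + b • v) := by rw [hab, one_smul]
      _ = a • (θ + s • u) + b • (θ + s • v) := by module
  simp only [hcomb]
  exact hf.2 (Set.mem_univ _) (Set.mem_univ _)
    (fun heq => huv (smul_right_injective E hs (add_left_cancel heq))) ha hb hab

variable {𝒳 : Type*} {d : ℕ} {h : 𝒳 → Fin d → ℝ} {m₁ m₂ : ℕ} {x₁ x₂ : ℕ → 𝒳} {q lam : ℝ}

lemma strictConcaveOn_empLogLik (h₁ : 0 < m₁) (h₂ : 0 < m₂)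
    (hsep : ∀ w : Param d, (∀ j < m₁, ⟪w, design h (x₁ j)⟫_ℝ = 0) →
      (∀ j < m₂, ⟪w, design h (x₂ j)⟫_ℝ = 0) → w = 0) :
    StrictConcaveOn ℝ Set.univ (empLogLik h m₁ m₂ x₁ x₂) := by
  have hφ : ∀ y : ℝ, StrictConcaveOn ℝ Set.univ fun t =>
      y * t - softplus (t + log (m₁ / m₂)) := fun y => by
    have hlin : ConcaveOn ℝ Set.univ fun t : ℝ => y * t :=
      (LinearMap.mulLeft ℝ y).concaveOn convex_univ
    have hsp := strictConvexOn_softplus.translate_left (log ((m₁ : ℝ) / m₂))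
    rw [Set.preimage_univ] at hsp
    exact (hlin.add_strictConcaveOn hsp.neg).congr fun t _ => (sub_eq_add_neg _ _).symm
  have hsum : empLogLik h m₁ m₂ x₁ x₂ = fun θ =>
      ∑ i ∈ (Finset.range m₁).disjSum (Finset.range m₂),
        (fun t => Sum.elim (fun _ => 1) (fun _ => 0) i * t - softplus (t + log (m₁ / m₂)))
          (innerₗ (Param d) (design h (Sum.elim x₁ x₂ i)) θ) := by
    funext θ
    rw [empLogLik_eq_sampleSum h h₁ h₂, Finset.sum_disjSum]
    simp only [sampleSum, obsLogLik, linPred_eq_inner, Sum.elim_inl, Sum.elim_inr,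
      innerₗ_apply_apply, real_inner_comm θ]
  rw [hsum]
  refine strictConcaveOn_sum_comp_of_separating (fun i => hφ _) fun w hw => hsep w ?_ ?_
  · exact fun j hj => by
      simpa [real_inner_comm] using hw (Sum.inl j) (by simpa using hj)
  · exact fun j hj => by
      simpa [real_inner_comm] using hw (Sum.inr j) (by simpa using hj)

lemma convexOn_bridgePenalty (hq : 1 ≤ q) :
    ConvexOn ℝ Set.univ (bridgePenalty q : Param d → ℝ) := by
  refine ⟨convex_univ, fun θ _ θ' _ a b ha hb hab => ?_⟩
  simp only [bridgePenalty, smul_eq_mul, Finset.mul_sum, ← Finset.sum_add_distrib]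
  gcongr with j
  calc |(a • θ + b • θ') j.succ| ^ q ≤ (a * |θ j.succ| + b * |θ' j.succ|) ^ q := by
        gcongr
        simpa [abs_mul, abs_of_nonneg ha, abs_of_nonneg hb] using
          abs_add_le (a * θ j.succ) (b * θ' j.succ)
    _ ≤ a * |θ j.succ| ^ q + b * |θ' j.succ| ^ q :=
        (convexOn_rpow hq).2 (abs_nonneg (θ j.succ)) (abs_nonneg (θ' j.succ)) ha hb hab

lemma differentiable_bridgePenalty (hq : 1 < q) :
    Differentiable ℝ (bridgePenalty q : Param d → ℝ) :=
  Differentiable.fun_sum fun j _ θ =>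
    DifferentiableAt.comp θ (g := fun t : ℝ => |t| ^ q)
      (hasDerivAt_abs_rpow _ hq).differentiableAt (by fun_prop)

lemma strictConcaveOn_penLogLik (hq : 1 ≤ q) (hlam : 0 ≤ lam)
    (hf : StrictConcaveOn ℝ Set.univ (empLogLik h m₁ m₂ x₁ x₂)) :
    StrictConcaveOn ℝ Set.univ (penLogLik h q lam m₁ m₂ x₁ x₂) :=
  hf.sub_convexOn ((convexOn_bridgePenalty hq).smul hlam)

end Concavity

section Penalty

variable {E : Type*} [NormedAddCommGroup E] [InnerProductSpace ℝ E] [CompleteSpace E]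
  {J : E → ℝ} {θ₀ : E} {s : ℕ → ℝ}

lemma eventually_abs_sub_inner_gradient_le (hJ : DifferentiableAt ℝ J θ₀)
    (hs : Tendsto s atTop (𝓝 0)) (R : ℝ) {e : ℝ} (he : 0 < e) :
    ∀ᶠ k in atTop, ∀ u, ‖u‖ ≤ R →
      |J (θ₀ + s k • u) - J θ₀ - s k * ⟪u, gradient J θ₀⟫_ℝ| ≤ e * |s k| := by
  rcases lt_or_ge R 0 with hR | hR
  · exact Eventually.of_forall fun k u hu => absurd (norm_nonneg u) (hu.trans_lt hR).not_ge
  have hlittle := (hasGradientAt_iff_isLittleO_nhds_zero.1 hJ.hasGradientAt).def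
    (by positivity : 0 < e / (R + 1))
  obtain ⟨t, ht, hball⟩ := Metric.eventually_nhds_iff_ball.1 hlittle
  have hsR : Tendsto (fun k => |s k| * R) atTop (𝓝 0) := by simpa using hs.abs.mul_const R
  filter_upwards [hsR.eventually_lt_const ht] with k hk u hu
  have hsu : ‖s k • u‖ ≤ |s k| * R := by rw [norm_smul, Real.norm_eq_abs]; gcongr
  have hrem := hball (s k • u) (mem_ball_zero_iff.2 (hsu.trans_lt hk))
  rw [Real.norm_eq_abs, real_inner_smul_right, real_inner_comm] at hrem
  calc |J (θ₀ + s k • u) - J θ₀ - s k * ⟪u, gradient J θ₀⟫_ℝ|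
      ≤ e / (R + 1) * (|s k| * R) := hrem.trans (by gcongr)
    _ ≤ e / (R + 1) * (|s k| * (R + 1)) := by gcongr; linarith
    _ = e * |s k| := by field_simp

lemma eventually_abs_penalty_expansion_le (hJ : DifferentiableAt ℝ J θ₀)
    (hs : Tendsto s atTop (𝓝 0)) {lam : ℕ → ℝ} {lam₀ : ℝ}
    (hlam : Tendsto (fun k => lam k * s k) atTop (𝓝 lam₀)) (R : ℝ) {η : ℝ} (hη : 0 < η) :
    ∀ᶠ k in atTop, ∀ u, ‖u‖ ≤ R →
      |lam k * (J (θ₀ + s k • u) - J θ₀) - lam₀ * ⟪u, gradient J θ₀⟫_ℝ| ≤ η := by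
  set b := gradient J θ₀
  have he : 0 < η / (|lam₀| + 1) := by positivity
  have hbound : Tendsto (fun k => η / (|lam₀| + 1) * |lam k * s k| + |lam k * s k - lam₀|
      * (R * ‖b‖)) atTop (𝓝 (η / (|lam₀| + 1) * |lam₀|)) := by
    simpa using (hlam.abs.const_mul (η / (|lam₀| + 1))).add
      ((hlam.sub_const lam₀).abs.mul_const (R * ‖b‖))
  have hlimit : η / (|lam₀| + 1) * |lam₀| < η := by
    rw [div_mul_eq_mul_div, div_lt_iff₀ (by positivity)]
    linarith
  filter_upwards [eventually_abs_sub_inner_gradient_le hJ hs R he,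
    hbound.eventually_lt_const hlimit] with k hrem hk u hu
  calc |lam k * (J (θ₀ + s k • u) - J θ₀) - lam₀ * ⟪u, b⟫_ℝ|
      = |lam k * (J (θ₀ + s k • u) - J θ₀ - s k * ⟪u, b⟫_ℝ)
          + (lam k * s k - lam₀) * ⟪u, b⟫_ℝ| := by ring_nf
    _ ≤ |lam k| * |J (θ₀ + s k • u) - J θ₀ - s k * ⟪u, b⟫_ℝ|
          + |lam k * s k - lam₀| * |⟪u, b⟫_ℝ| := by
        rw [← abs_mul, ← abs_mul]; exact abs_add_le _ _
    _ ≤ |lam k| * (η / (|lam₀| + 1) * |s k|) + |lam k * s k - lam₀| * (R * ‖b‖) := by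
        gcongr
        · exact hrem u hu
        · exact (abs_real_inner_le_norm u b).trans (by gcongr)
    _ ≤ η := by rw [abs_mul] at hk; linarith

end Penalty

section LocalProcess

variable {𝒳 : Type*} {d : ℕ} (h : 𝒳 → Fin d → ℝ)

/-- The penalized log-likelihood in the local parameter `u = n ^ (1/2) (θ - θ₀)`. -/
def localPenLogLik (q lam : ℝ) (m₁ m₂ : ℕ) (x₁ x₂ : ℕ → 𝒳) (θ₀ u : Param d) : ℝ :=
  penLogLik h q lam m₁ m₂ x₁ x₂ (θ₀ + localScale m₁ m₂ • u)

variable {h} {q lam : ℝ} {m₁ m₂ : ℕ} {x₁ x₂ : ℕ → 𝒳} {θ₀ : Param d}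

lemma isPenMaximizer_add_smul_iff {s : ℝ} (hs : s ≠ 0) {u : Param d} :
    IsPenMaximizer h q lam m₁ m₂ x₁ x₂ (θ₀ + s • u) ↔
      IsMaxOn (fun u => penLogLik h q lam m₁ m₂ x₁ x₂ (θ₀ + s • u)) Set.univ u := by
  refine ⟨fun hmax v _ => hmax _, fun hmax θ => ?_⟩
  have := hmax (Set.mem_univ (s⁻¹ • (θ - θ₀)))
  simpa [smul_smul, hs] using this

lemma existsUnique_isPenMaximizer_iff (h₁ : 0 < m₁) :
    (∃! θ, IsPenMaximizer h q lam m₁ m₂ x₁ x₂ θ) ↔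
      ∃! u, IsMaxOn (localPenLogLik h q lam m₁ m₂ x₁ x₂ θ₀) Set.univ u := by
  have hs := (localScale_pos (m₂ := m₂) h₁).ne'
  have hbij : Function.Bijective fun u : Param d => θ₀ + localScale m₁ m₂ • u :=
    (Equiv.addLeft θ₀).bijective.comp (MulAction.bijective₀ hs)
  rw [hbij.existsUnique_iff]
  simp only [isPenMaximizer_add_smul_iff hs]
  rfl

lemma IsPenMaximizer.isMaxOn_local {θ : Param d} (h₁ : 0 < m₁)
    (hθ : IsPenMaximizer h q lam m₁ m₂ x₁ x₂ θ) :
    IsMaxOn (localPenLogLik h q lam m₁ m₂ x₁ x₂ θ₀) Set.univ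
      (√((m₁ + m₂ : ℕ) : ℝ) • (θ - θ₀)) := by
  refine (isPenMaximizer_add_smul_iff (localScale_pos h₁).ne').1 ?_
  have hsize : √((m₁ + m₂ : ℕ) : ℝ) ≠ 0 := by positivity
  rwa [localScale, smul_smul, inv_mul_cancel₀ hsize, one_smul, add_sub_cancel]

variable {T : Param d →L[ℝ] Param d} {c κ : ℝ}

lemma eq_zero_of_norm_sampleMean_obsInfo_sub_lt (hT : ∀ v, κ * ‖v‖ ^ 2 ≤ ⟪v, T v⟫_ℝ)
    (hinfo : ‖sampleMean (obsInfo h c θ₀) (obsInfo h c θ₀) m₁ m₂ x₁ x₂ - T‖ < κ) {w : Param d}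
    (hw₁ : ∀ j < m₁, ⟪w, design h (x₁ j)⟫_ℝ = 0) (hw₂ : ∀ j < m₂, ⟪w, design h (x₂ j)⟫_ℝ = 0) :
    w = 0 := by
  set B := sampleMean (obsInfo h c θ₀) (obsInfo h c θ₀) m₁ m₂ x₁ x₂ with hB
  have hzero : ∀ x, ⟪w, design h x⟫_ℝ = 0 → obsInfo h c θ₀ x w = 0 := fun x hx => by
    simp [obsInfo, designOuter_apply, real_inner_comm, hx]
  have hBw : B w = 0 := by
    rw [hB, sampleMean, sampleSum, smul_apply, add_apply, sum_apply, sum_apply,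
      Finset.sum_eq_zero fun j hj => hzero _ (hw₁ j (Finset.mem_range.1 hj)),
      Finset.sum_eq_zero fun j hj => hzero _ (hw₂ j (Finset.mem_range.1 hj)), add_zero, smul_zero]
  by_contra hne
  have : 0 < ‖w‖ ^ 2 := by positivity
  refine lt_irrefl (κ * ‖w‖ ^ 2) ?_
  calc κ * ‖w‖ ^ 2 ≤ ⟪w, T w⟫_ℝ := hT w
    _ = -⟪w, (B - T) w⟫_ℝ := by rw [sub_apply, hBw, zero_sub, inner_neg_right, neg_neg]
    _ ≤ ‖w‖ * (‖B - T‖ * ‖w‖) := (neg_le_abs _).trans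
        ((abs_real_inner_le_norm _ _).trans (by gcongr; exact (B - T).le_opNorm w))
    _ = ‖B - T‖ * ‖w‖ ^ 2 := by ring
    _ < κ * ‖w‖ ^ 2 := by gcongr

lemma strictConcaveOn_localPenLogLik (hq : 1 ≤ q) (hlam : 0 ≤ lam) (h₁ : 0 < m₁) (h₂ : 0 < m₂)
    (hT : ∀ v, κ * ‖v‖ ^ 2 ≤ ⟪v, T v⟫_ℝ)
    (hinfo : ‖sampleMean (obsInfo h c θ₀) (obsInfo h c θ₀) m₁ m₂ x₁ x₂ - T‖ < κ) :
    StrictConcaveOn ℝ Set.univ (localPenLogLik h q lam m₁ m₂ x₁ x₂ θ₀) :=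
  strictConcaveOn_comp_add_smul
    (strictConcaveOn_penLogLik hq hlam (strictConcaveOn_empLogLik h₁ h₂ fun _ =>
      eq_zero_of_norm_sampleMean_obsInfo_sub_lt hT hinfo)) θ₀ (localScale_pos h₁).ne'

lemma abs_localPenLogLik_sub_quadModel_le {r δ R e lam₀ : ℝ} {K : 𝒳 → ℝ} {a b u : Param d}
    (hK : ∀ θ ∈ Metric.ball θ₀ r, ∀ x, ‖obsInfo h c θ x‖ ≤ K x) (h₁ : 0 < m₁) (h₂ : 0 < m₂)
    (ha : T a = localScale m₁ m₂ • score h (log (m₁ / m₂)) θ₀ m₁ m₂ x₁ x₂ - lam₀ • b)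
    (hδ : δ < r) (hδR : |log (m₁ / m₂) - c| + localScale m₁ m₂ * R ≤ δ)
    (hmod : sampleMean (infoModulus h K δ) (infoModulus h K δ) m₁ m₂ x₁ x₂ ≤ e)
    (hinfo : ‖sampleMean (obsInfo h c θ₀) (obsInfo h c θ₀) m₁ m₂ x₁ x₂ - T‖ ≤ e)
    (hpen : |lam * (bridgePenalty q (θ₀ + localScale m₁ m₂ • u) - bridgePenalty q θ₀)
      - lam₀ * ⟪u, b⟫_ℝ| ≤ e) (hu : ‖u‖ ≤ R) :
    |localPenLogLik h q lam m₁ m₂ x₁ x₂ θ₀ u - localPenLogLik h q lam m₁ m₂ x₁ x₂ θ₀ 0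
      - quadModel T a u| ≤ 2 * (R ^ 2 + 1) * e := by
  have hs := localScale_nonneg m₁ m₂
  have he : 0 ≤ e := (norm_nonneg _).trans hinfo
  have hu2 : ‖u‖ ^ 2 ≤ R ^ 2 := by gcongr
  have hsu : ‖localScale m₁ m₂ • u‖ = localScale m₁ m₂ * ‖u‖ := by
    rw [norm_smul, Real.norm_of_nonneg hs]
  have hlik := abs_empLogLik_expansion_le hK h₁ h₂ x₁ x₂ hδ (w := localScale m₁ m₂ • u)
    (hδR.trans' (by rw [hsu]; gcongr))
  have hcurv : |⟪u, sampleMean (obsInfo h c θ₀) (obsInfo h c θ₀) m₁ m₂ x₁ x₂ u⟫_ℝ - ⟪u, T u⟫_ℝ|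
      ≤ e * R ^ 2 := by
    rw [← inner_sub_right, ← sub_apply]
    refine (abs_real_inner_le_norm _ _).trans ?_
    calc _ ≤ ‖u‖ * (e * ‖u‖) := by gcongr; exact ContinuousLinearMap.le_of_opNorm_le _ hinfo u
      _ = e * ‖u‖ ^ 2 := by ring
      _ ≤ e * R ^ 2 := by gcongr
  have hmodR : sampleMean (infoModulus h K δ) (infoModulus h K δ) m₁ m₂ x₁ x₂ * ‖u‖ ^ 2
      ≤ e * R ^ 2 := by gcongr
  simp only [sampleMean, ← localScale_sq, smul_apply, real_inner_smul_right, smul_eq_mul]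
    at hcurv hmodR
  simp only [hsu, mul_pow, map_smul, real_inner_smul_left, real_inner_smul_right] at hlik
  simp only [quadModel, ha, localPenLogLik, penLogLik, smul_zero, add_zero, inner_sub_right,
    real_inner_smul_right]
  rw [abs_le] at hlik hcurv hpen ⊢
  constructor <;> nlinarith [hlik.1, hlik.2, hcurv.1, hcurv.2, hpen.1, hpen.2]

end LocalProcess

/-! ### Limit theorems for two independent samples -/

section SampleSizes

/-- The sampling regime: the total sample size tends to infinity, and the ratio of the two sample
sizes tends to `ρ > 0`. -/
structure SampleSizes (n₁ n₂ : ℕ → ℕ) (ρ : ℝ) : Prop where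
  pos : 0 < ρ
  tendsto_add : Tendsto (fun k => n₁ k + n₂ k) atTop atTop
  tendsto_ratio : Tendsto (fun k => (n₁ k : ℝ) / n₂ k) atTop (𝓝 ρ)

namespace SampleSizes

variable {n₁ n₂ : ℕ → ℕ} {ρ : ℝ} (hn : SampleSizes n₁ n₂ ρ)
include hn

lemma eventually_pos : ∀ᶠ k in atTop, 0 < n₁ k ∧ 0 < n₂ k := by
  filter_upwards [hn.tendsto_ratio.eventually_const_lt hn.pos] with k hk
  by_contra! hzero
  rcases Nat.eq_zero_or_pos (n₁ k) with h₁ | h₁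
  · simp [h₁] at hk
  · simp [Nat.le_zero.1 (hzero h₁)] at hk

lemma tendsto_fst_div :
    Tendsto (fun k => (n₁ k : ℝ) / (n₁ k + n₂ k : ℕ)) atTop (𝓝 (ρ / (1 + ρ))) := by
  have hρ : 1 + ρ ≠ 0 := by linarith [hn.pos]
  refine (hn.tendsto_ratio.div (hn.tendsto_ratio.const_add 1) hρ).congr' ?_
  filter_upwards [hn.eventually_pos] with k ⟨_, h₂⟩
  simp only [Pi.div_apply]
  push_cast
  field_simp
  ring

lemma tendsto_snd_div :
    Tendsto (fun k => (n₂ k : ℝ) / (n₁ k + n₂ k : ℕ)) atTop (𝓝 (1 / (1 + ρ))) := by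
  have hρ : 1 + ρ ≠ 0 := by linarith [hn.pos]
  refine ((hn.tendsto_ratio.const_add 1).inv₀ hρ).congr' ?_ |>.trans_eq (by rw [one_div])
  filter_upwards [hn.eventually_pos] with k ⟨_, h₂⟩
  push_cast
  field_simp
  ring

lemma tendsto_fst : Tendsto n₁ atTop atTop := by
  have hcast : Tendsto (fun k => ((n₁ k + n₂ k : ℕ) : ℝ)) atTop atTop :=
    tendsto_natCast_atTop_atTop.comp hn.tendsto_add
  refine tendsto_natCast_atTop_iff.1 ((hcast.atTop_mul_pos
    (div_pos hn.pos (by linarith [hn.pos])) hn.tendsto_fst_div).congr' ?_)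
  filter_upwards [hn.eventually_pos] with k ⟨h₁, _⟩
  field_simp

lemma tendsto_snd : Tendsto n₂ atTop atTop := by
  have hcast : Tendsto (fun k => ((n₁ k + n₂ k : ℕ) : ℝ)) atTop atTop :=
    tendsto_natCast_atTop_atTop.comp hn.tendsto_add
  refine tendsto_natCast_atTop_iff.1 ((hcast.atTop_mul_pos
    (div_pos one_pos (by linarith [hn.pos])) hn.tendsto_snd_div).congr' ?_)
  filter_upwards [hn.eventually_pos] with k ⟨h₁, _⟩
  field_simp

lemma tendsto_log_ratio : Tendsto (fun k => log ((n₁ k : ℝ) / n₂ k)) atTop (𝓝 (log ρ)) :=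
  hn.tendsto_ratio.log hn.pos.ne'

lemma tendsto_localScale : Tendsto (fun k => localScale (n₁ k) (n₂ k)) atTop (𝓝 0) :=
  (tendsto_sqrt_atTop.comp (tendsto_natCast_atTop_atTop.comp hn.tendsto_add)).inv_tendsto_atTop

end SampleSizes

end SampleSizes

section Sampling

variable {Ω : Type*} [MeasurableSpace Ω] {P : Measure Ω} {𝒳 : Type*} [MeasurableSpace 𝒳]

/-- Two independent samples, from the laws `G₁` and `G₂`. -/
structure TwoSample (X₁ X₂ : ℕ → Ω → 𝒳) (G₁ G₂ : Measure 𝒳) (P : Measure Ω) : Prop where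
  law₁ : ∀ j, HasLaw (X₁ j) G₁ P
  law₂ : ∀ j, HasLaw (X₂ j) G₂ P
  indep : iIndepFun (fun s : ℕ ⊕ ℕ => Sum.elim X₁ X₂ s) P

variable {E : Type*} [NormedAddCommGroup E]
  {G G₁ G₂ : Measure 𝒳} {X X₁ X₂ : ℕ → Ω → 𝒳} {n₁ n₂ : ℕ → ℕ} {ρ : ℝ}

lemma TwoSample.iIndepFun_fst (hX : TwoSample X₁ X₂ G₁ G₂ P) : iIndepFun X₁ P :=
  hX.indep.precomp (g := Sum.inl) Sum.inl_injective

lemma TwoSample.iIndepFun_snd (hX : TwoSample X₁ X₂ G₁ G₂ P) : iIndepFun X₂ P :=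
  hX.indep.precomp (g := Sum.inr) Sum.inr_injective

lemma memLp_comp_of_hasLaw {Y : Ω → 𝒳} {p : ENNReal} {f : 𝒳 → E}
    (hY : HasLaw Y G P) (hf : MemLp f p G) : MemLp (fun ω => f (Y ω)) p P := by
  rw [← hY.map_eq] at hf
  exact (memLp_map_measure_iff hf.aestronglyMeasurable hY.aemeasurable).1 hf

variable [NormedSpace ℝ E] [MeasurableSpace E] [BorelSpace E]

lemma ae_tendsto_average [CompleteSpace E] (hX : ∀ j, HasLaw (X j) G P) (hind : iIndepFun X P)
    {f : 𝒳 → E} (hf : Integrable f G) {m N : ℕ → ℕ} {p : ℝ}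
    (hm : Tendsto m atTop atTop)
    (hp : Tendsto (fun k => (m k : ℝ) / N k) atTop (𝓝 p)) :
    ∀ᵐ ω ∂P, Tendsto (fun k => (N k : ℝ)⁻¹ • ∑ j ∈ Finset.range (m k), f (X j ω)) atTop
      (𝓝 (p • ∫ x, f x ∂G)) := by
  have hint : Integrable (fun ω => f (X 0 ω)) P :=
    memLp_one_iff_integrable.1 (memLp_comp_of_hasLaw (hX 0) (memLp_one_iff_integrable.2 hf))
  have hmeas : ∀ j, AEMeasurable f (P.map (X j)) := fun j => (hX j).map_eq ▸ hf.aemeasurable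
  have hslln := strong_law_ae (fun j ω => f (X j ω)) hint
    (fun i j hij => (hind.indepFun hij).comp₀ (hX i).aemeasurable (hX j).aemeasurable
      (hmeas i) (hmeas j))
    (fun i => ((hX i).identDistrib (hX 0)).comp_of_aemeasurable (hmeas i))
  have hmean : ∫ ω, f (X 0 ω) ∂P = ∫ x, f x ∂G := (hX 0).integral_comp hf.aestronglyMeasurable
  filter_upwards [hslln] with ω hω
  rw [hmean] at hω
  refine (hp.smul (hω.comp hm)).congr' ?_
  filter_upwards [hm.eventually_gt_atTop 0] with k hk
  have hk' : (m k : ℝ) ≠ 0 := by positivity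
  rw [Function.comp_apply, smul_smul]
  congr 1
  field_simp

lemma tendstoInMeasure_sampleMean [IsFiniteMeasure P] [CompleteSpace E]
    (hX : TwoSample X₁ X₂ G₁ G₂ P) (hn : SampleSizes n₁ n₂ ρ) {f₁ f₂ : 𝒳 → E}
    (hf₁ : Integrable f₁ G₁) (hf₂ : Integrable f₂ G₂) :
    TendstoInMeasure P (fun k ω => sampleMean f₁ f₂ (n₁ k) (n₂ k) (X₁ · ω) (X₂ · ω)) atTop
      fun _ => (ρ / (1 + ρ)) • ∫ x, f₁ x ∂G₁ + (1 / (1 + ρ)) • ∫ x, f₂ x ∂G₂ := by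
  have hc₁ : ∀ j, AEStronglyMeasurable (fun ω => f₁ (X₁ j ω)) P := fun j =>
    (memLp_comp_of_hasLaw (hX.law₁ j) (memLp_one_iff_integrable.2 hf₁)).aestronglyMeasurable
  have hc₂ : ∀ j, AEStronglyMeasurable (fun ω => f₂ (X₂ j ω)) P := fun j =>
    (memLp_comp_of_hasLaw (hX.law₂ j) (memLp_one_iff_integrable.2 hf₂)).aestronglyMeasurable
  refine tendstoInMeasure_of_tendsto_ae (fun k => ?_) ?_
  · exact ((Finset.aestronglyMeasurable_fun_sum _ fun j _ => hc₁ j).add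
      (Finset.aestronglyMeasurable_fun_sum _ fun j _ => hc₂ j)).const_smul _
  · filter_upwards [
      ae_tendsto_average hX.law₁ hX.iIndepFun_fst hf₁ hn.tendsto_fst hn.tendsto_fst_div,
      ae_tendsto_average hX.law₂ hX.iIndepFun_snd hf₂ hn.tendsto_snd hn.tendsto_snd_div]
      with ω hω₁ hω₂
    simpa only [sampleMean, sampleSum, smul_add] using hω₁.add hω₂

end Sampling

section SecondMoments

variable {Ω : Type*} [MeasurableSpace Ω] {P : Measure Ω} {𝒳 : Type*} [MeasurableSpace 𝒳]
  {G G₁ G₂ : Measure 𝒳} {X₁ X₂ : ℕ → Ω → 𝒳}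

/-- The deviation of `f` from its mean under `G`. -/
def centered {E : Type*} [NormedAddCommGroup E] [NormedSpace ℝ E] (G : Measure 𝒳) (f : 𝒳 → E)
    (x : 𝒳) : E :=
  f x - ∫ y, f y ∂G

lemma TwoSample.iIndepFun_comp {E : Type*} [MeasurableSpace E] (hX : TwoSample X₁ X₂ G₁ G₂ P)
    {f₁ f₂ : 𝒳 → E} (hf₁ : Measurable f₁) (hf₂ : Measurable f₂) :
    iIndepFun (Sum.elim (fun j ω => f₁ (X₁ j ω)) fun j ω => f₂ (X₂ j ω)) P := by
  convert hX.indep.comp (fun s => Sum.elim (fun _ : ℕ => f₁) (fun _ : ℕ => f₂) s)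
    (by rintro (_ | _); exacts [hf₁, hf₂]) with s
  rcases s with _ | _ <;> rfl

variable {E : Type*} [NormedAddCommGroup E]

lemma tendstoInMeasure_zero_of_tendsto_integral_norm_sq [IsFiniteMeasure P] {Y : ℕ → Ω → E}
    (hY : ∀ k, MemLp (Y k) 2 P) (hlim : Tendsto (fun k => ∫ ω, ‖Y k ω‖ ^ 2 ∂P) atTop (𝓝 0)) :
    TendstoInMeasure P Y atTop fun _ => 0 := by
  rw [tendstoInMeasure_iff_measureReal_norm]
  intro ε hε
  have hbound : ∀ k, P.real {ω | ε ≤ ‖Y k ω - 0‖} ≤ (∫ ω, ‖Y k ω‖ ^ 2 ∂P) / ε ^ 2 := fun k => by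
    have hmarkov := mul_meas_ge_le_integral_of_nonneg (μ := P) (ae_of_all _ fun _ => sq_nonneg _)
      (hY k).norm.integrable_sq (ε ^ 2)
    simp only [pow_le_pow_iff_left₀ hε.le (norm_nonneg _) two_ne_zero] at hmarkov
    rw [le_div_iff₀' (by positivity)]
    simpa only [sub_zero] using hmarkov
  exact squeeze_zero (fun _ => measureReal_nonneg) hbound (by simpa using hlim.div_const (ε ^ 2))

lemma memLp_sampleSum (hX : TwoSample X₁ X₂ G₁ G₂ P) {p : ENNReal} {f₁ f₂ : 𝒳 → E}
    (hf₁ : MemLp f₁ p G₁) (hf₂ : MemLp f₂ p G₂) (m₁ m₂ : ℕ) :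
    MemLp (fun ω => sampleSum f₁ f₂ m₁ m₂ (X₁ · ω) (X₂ · ω)) p P :=
  (memLp_finsetSum _ fun j _ => memLp_comp_of_hasLaw (f := f₁) (hX.law₁ j) hf₁).add
    (memLp_finsetSum _ fun j _ => memLp_comp_of_hasLaw (f := f₂) (hX.law₂ j) hf₂)

section NormedSpace

variable [NormedSpace ℝ E]

lemma memLp_centered [IsProbabilityMeasure G] {f : 𝒳 → E} (hf : MemLp f 2 G) :
    MemLp (centered G f) 2 G :=
  hf.sub (memLp_const _)

lemma measurable_centered [MeasurableSpace E] [BorelSpace E] {f : 𝒳 → E} (hf : Measurable f) :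
    Measurable (centered G f) :=
  hf.sub_const _

lemma centered_sub {f g : 𝒳 → E} (hf : Integrable f G) (hg : Integrable g G) :
    centered G (fun x => f x - g x) = fun x => centered G f x - centered G g x := by
  funext x
  simp only [centered, integral_sub hf hg, sub_sub_sub_comm]

end NormedSpace

variable [InnerProductSpace ℝ E]

lemma integrable_inner_of_memLp_two {μ : Measure 𝒳} {f g : 𝒳 → E} (hf : MemLp f 2 μ)
    (hg : MemLp g 2 μ) : Integrable (fun x => ⟪f x, g x⟫_ℝ) μ :=
  memLp_one_iff_integrable.1 ((innerSL ℝ).memLp_of_bilin 1 hf hg)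

variable [CompleteSpace E]

lemma integral_centered [IsProbabilityMeasure G] {f : 𝒳 → E} (hf : Integrable f G) :
    ∫ x, centered G f x ∂G = 0 := by
  simp [centered, integral_sub hf (integrable_const _)]

lemma integral_norm_centered_sq_le [IsProbabilityMeasure G] {f : 𝒳 → E} (hf : MemLp f 2 G) :
    ∫ x, ‖centered G f x‖ ^ 2 ∂G ≤ ∫ x, ‖f x‖ ^ 2 ∂G := by
  have hint : Integrable f G := hf.integrable (by norm_num)
  have hsq : Integrable (fun x => ‖f x‖ ^ 2) G := hf.norm.integrable_sq
  have hcross : Integrable (fun x => 2 * ⟪f x, ∫ y, f y ∂G⟫_ℝ) G :=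
    (hint.inner_const _).const_mul 2
  have hexpand : ∫ x, ‖centered G f x‖ ^ 2 ∂G = ∫ x, ‖f x‖ ^ 2 ∂G - ‖∫ x, f x ∂G‖ ^ 2 := by
    simp only [centered, norm_sub_sq_real]
    rw [integral_add (f := fun x => ‖f x‖ ^ 2 - 2 * ⟪f x, ∫ y, f y ∂G⟫_ℝ) (hsq.sub hcross)
      (integrable_const _), integral_sub hsq hcross, integral_const_mul]
    simp only [real_inner_comm (∫ y, f y ∂G) (f _), integral_inner hint, real_inner_self_eq_norm_sq,
      integral_const, probReal_univ, one_smul]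
    ring
  linarith [sq_nonneg ‖∫ x, f x ∂G‖]

variable [MeasurableSpace E] [BorelSpace E]

lemma integral_norm_sum_sq {ι : Type*} {s : Finset ι} {Y : ι → Ω → E} [IsFiniteMeasure P]
    (hY : ∀ i ∈ s, MemLp (Y i) 2 P) (hmean : ∀ i ∈ s, ∫ ω, Y i ω ∂P = 0)
    (hind : Set.Pairwise (s : Set ι) fun i j => IndepFun (Y i) (Y j) P) :
    ∫ ω, ‖∑ i ∈ s, Y i ω‖ ^ 2 ∂P = ∑ i ∈ s, ∫ ω, ‖Y i ω‖ ^ 2 ∂P := by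
  have hint : ∀ i ∈ s, Integrable (Y i) P := fun i hi => (hY i hi).integrable (by norm_num)
  have horth : ∀ i ∈ s, ∀ j ∈ s, i ≠ j → ∫ ω, ⟪Y i ω, Y j ω⟫_ℝ ∂P = 0 := fun i hi j hj hij =>
    ((hind hi hj hij).integral_bilin (hint i hi) (hint j hj) (innerSL ℝ)).trans
      (by rw [hmean i hi, map_zero, zero_apply])
  simp only [← real_inner_self_eq_norm_sq, sum_inner, inner_sum]
  rw [integral_finsetSum _ fun i hi => integrable_finsetSum _ fun j hj =>
    integrable_inner_of_memLp_two (hY j hj) (hY i hi)]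
  refine Finset.sum_congr rfl fun i hi => ?_
  rw [integral_finsetSum _ fun j hj => integrable_inner_of_memLp_two (hY j hj) (hY i hi)]
  exact Finset.sum_eq_single_of_mem i hi fun j hj hji => horth j hj i hi hji

variable [IsProbabilityMeasure P] [IsProbabilityMeasure G₁] [IsProbabilityMeasure G₂]

lemma integral_norm_sampleSum_centered_sq_le (hX : TwoSample X₁ X₂ G₁ G₂ P) {f₁ f₂ : 𝒳 → E}
    (hm₁ : Measurable f₁) (hm₂ : Measurable f₂) (hf₁ : MemLp f₁ 2 G₁) (hf₂ : MemLp f₂ 2 G₂)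
    (m₁ m₂ : ℕ) :
    ∫ ω, ‖sampleSum (centered G₁ f₁) (centered G₂ f₂) m₁ m₂ (X₁ · ω) (X₂ · ω)‖ ^ 2 ∂P
      ≤ m₁ * ∫ x, ‖f₁ x‖ ^ 2 ∂G₁ + m₂ * ∫ x, ‖f₂ x‖ ^ 2 ∂G₂ := by
  set Y : ℕ ⊕ ℕ → Ω → E :=
    Sum.elim (fun j ω => centered G₁ f₁ (X₁ j ω)) fun j ω => centered G₂ f₂ (X₂ j ω)
  have hc₁ := memLp_centered hf₁
  have hc₂ := memLp_centered hf₂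
  have hY : ∀ s, MemLp (Y s) 2 P := by
    rintro (j | j)
    exacts [memLp_comp_of_hasLaw (f := centered G₁ f₁) (hX.law₁ j) hc₁,
      memLp_comp_of_hasLaw (f := centered G₂ f₂) (hX.law₂ j) hc₂]
  have hmean : ∀ s, ∫ ω, Y s ω ∂P = 0 := by
    rintro (j | j)
    · exact ((hX.law₁ j).integral_comp hc₁.aestronglyMeasurable).trans
        (integral_centered (hf₁.integrable (by norm_num)))
    · exact ((hX.law₂ j).integral_comp hc₂.aestronglyMeasurable).trans
        (integral_centered (hf₂.integrable (by norm_num)))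
  have hind : iIndepFun Y P := hX.iIndepFun_comp (measurable_centered hm₁) (measurable_centered hm₂)
  have hsq₁ : ∀ j, ∫ ω, ‖Y (.inl j) ω‖ ^ 2 ∂P ≤ ∫ x, ‖f₁ x‖ ^ 2 ∂G₁ := fun j =>
    ((hX.law₁ j).integral_comp (f := fun x => ‖centered G₁ f₁ x‖ ^ 2)
      hc₁.norm.integrable_sq.aestronglyMeasurable).trans_le (integral_norm_centered_sq_le hf₁)
  have hsq₂ : ∀ j, ∫ ω, ‖Y (.inr j) ω‖ ^ 2 ∂P ≤ ∫ x, ‖f₂ x‖ ^ 2 ∂G₂ := fun j =>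
    ((hX.law₂ j).integral_comp (f := fun x => ‖centered G₂ f₂ x‖ ^ 2)
      hc₂.norm.integrable_sq.aestronglyMeasurable).trans_le (integral_norm_centered_sq_le hf₂)
  have hsum := integral_norm_sum_sq (s := (Finset.range m₁).disjSum (Finset.range m₂))
    (fun s _ => hY s) (fun s _ => hmean s) fun s _ t _ hst => hind.indepFun hst
  simp only [Finset.sum_disjSum] at hsum
  refine hsum.trans_le (add_le_add ?_ ?_)
  · exact (Finset.sum_le_sum fun j _ => hsq₁ j).trans_eq (by simp)
  · exact (Finset.sum_le_sum fun j _ => hsq₂ j).trans_eq (by simp)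

lemma tendstoInMeasure_localScale_smul_sampleSum_centered (hX : TwoSample X₁ X₂ G₁ G₂ P)
    {f₁ f₂ : ℕ → 𝒳 → E} (hm₁ : ∀ k, Measurable (f₁ k)) (hm₂ : ∀ k, Measurable (f₂ k))
    (hf₁ : ∀ k, MemLp (f₁ k) 2 G₁) (hf₂ : ∀ k, MemLp (f₂ k) 2 G₂)
    (hlim₁ : Tendsto (fun k => ∫ x, ‖f₁ k x‖ ^ 2 ∂G₁) atTop (𝓝 0))
    (hlim₂ : Tendsto (fun k => ∫ x, ‖f₂ k x‖ ^ 2 ∂G₂) atTop (𝓝 0)) (n₁ n₂ : ℕ → ℕ) :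
    TendstoInMeasure P (fun k ω => localScale (n₁ k) (n₂ k) •
      sampleSum (centered G₁ (f₁ k)) (centered G₂ (f₂ k)) (n₁ k) (n₂ k) (X₁ · ω) (X₂ · ω))
      atTop fun _ => 0 := by
  refine tendstoInMeasure_zero_of_tendsto_integral_norm_sq (fun k => ?_) <|
    squeeze_zero (fun _ => by positivity) (fun k => ?_) (by simpa using hlim₁.add hlim₂)
  · exact (memLp_sampleSum hX (memLp_centered (hf₁ k)) (memLp_centered (hf₂ k)) _ _).const_smul
      (localScale (n₁ k) (n₂ k))
  · have hsum := integral_norm_sampleSum_centered_sq_le hX (hm₁ k) (hm₂ k) (hf₁ k) (hf₂ k)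
      (n₁ k) (n₂ k)
    have ha : 0 ≤ ∫ x, ‖f₁ k x‖ ^ 2 ∂G₁ := by positivity
    have hb : 0 ≤ ∫ x, ‖f₂ k x‖ ^ 2 ∂G₂ := by positivity
    simp only [norm_smul, mul_pow, norm_eq_abs, sq_abs, localScale_sq, integral_const_mul]
    refine inv_mul_le_of_le_mul₀ (Nat.cast_nonneg _) (by positivity) (hsum.trans ?_)
    push_cast
    nlinarith [mul_nonneg (Nat.cast_nonneg (α := ℝ) (n₁ k)) hb,
      mul_nonneg (Nat.cast_nonneg (α := ℝ) (n₂ k)) ha]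

end SecondMoments

section CentralLimit

open Matrix (toEuclideanCLM)

section Law

variable {Ω : Type*} [MeasurableSpace Ω] {P : Measure Ω} [IsProbabilityMeasure P]

lemma tendstoInDistribution_id_of_hasLaw {E : Type*} [TopologicalSpace E] [MeasurableSpace E]
    [OpensMeasurableSpace E] {Ω' : Type*} [MeasurableSpace Ω'] {P' : Measure Ω'}
    [IsProbabilityMeasure P'] {Y : ℕ → Ω → E} {Z : Ω' → E} {μ : Measure E} [IsProbabilityMeasure μ]
    (hY : TendstoInDistribution Y atTop Z (fun _ => P) P') (hZ : HasLaw Z μ P') :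
    TendstoInDistribution Y atTop id (fun _ => P) μ where
  forall_aemeasurable := hY.forall_aemeasurable
  tendsto := by
    refine hY.tendsto.trans_eq (congrArg 𝓝 (Subtype.ext ?_))
    exact hZ.map_eq.trans Measure.map_id.symm

end Law

section Distribution

variable {Ω : Type*} [MeasurableSpace Ω] {P : Measure Ω}

variable {E : Type*} [NormedAddCommGroup E] [InnerProductSpace ℝ E]
  [FiniteDimensional ℝ E] [MeasurableSpace E] [BorelSpace E]

lemma charFun_map_eq_charFun_map_inner_one {Y : Ω → E} (hY : AEMeasurable Y P) (t : E) :
    charFun (P.map Y) t = charFun (P.map fun ω => ⟪t, Y ω⟫_ℝ) 1 := by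
  rw [charFun_apply, charFun_apply, integral_map hY (by fun_prop),
    integral_map (by fun_prop) (by fun_prop)]
  simp [real_inner_comm]

lemma charFun_map_clm {F : Type*} [NormedAddCommGroup F] [InnerProductSpace ℝ F]
    [CompleteSpace F] [MeasurableSpace F] [BorelSpace F] [SecondCountableTopology F]
    (L : E →L[ℝ] F) (μ : Measure E) (t : F) :
    charFun (μ.map L) t = charFun μ (L.adjoint t) := by
  rw [charFun_apply, charFun_apply, integral_map (by fun_prop) (by fun_prop)]
  simp only [ContinuousLinearMap.adjoint_inner_right]

variable [IsProbabilityMeasure P]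

lemma tendstoInDistribution_id_iff_tendsto_charFun {Y : ℕ → Ω → E} (hY : ∀ k, AEMeasurable (Y k) P)
    {μ : Measure E} [IsProbabilityMeasure μ] :
    TendstoInDistribution Y atTop id (fun _ => P) μ ↔
      ∀ t, Tendsto (fun k => charFun (P.map (Y k)) t) atTop (𝓝 (charFun μ t)) := by
  refine ⟨fun h t => ?_, fun h => ⟨hY, aemeasurable_id, ?_⟩⟩
  · simpa only [ProbabilityMeasure.coe_mk, Measure.map_id] using
      ProbabilityMeasure.tendsto_iff_tendsto_charFun.1 h.tendsto t
  · exact ProbabilityMeasure.tendsto_iff_tendsto_charFun.2 fun t => by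
      simpa only [ProbabilityMeasure.coe_mk, Measure.map_id] using h t

lemma tendstoInDistribution_add_of_indepFun {Y Z : ℕ → Ω → E} {μ ν : Measure E}
    [IsProbabilityMeasure μ] [IsProbabilityMeasure ν]
    (hY : TendstoInDistribution Y atTop id (fun _ => P) μ)
    (hZ : TendstoInDistribution Z atTop id (fun _ => P) ν)
    (hind : ∀ k, IndepFun (Y k) (Z k) P) :
    TendstoInDistribution (fun k ω => Y k ω + Z k ω) atTop id (fun _ => P) (μ ∗ ν) := by
  have hYm := hY.forall_aemeasurable
  have hZm := hZ.forall_aemeasurable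
  rw [tendstoInDistribution_id_iff_tendsto_charFun hYm] at hY
  rw [tendstoInDistribution_id_iff_tendsto_charFun hZm] at hZ
  refine (tendstoInDistribution_id_iff_tendsto_charFun fun k => (hYm k).add (hZm k)).2 fun t => ?_
  rw [charFun_conv]
  refine ((hY t).mul (hZ t)).congr fun k => ?_
  exact (congrFun ((hind k).charFun_map_fun_add_eq_mul (hYm k) (hZm k)) t).symm

end Distribution

section Gaussian

variable {Ω : Type*} [MeasurableSpace Ω] {P : Measure Ω} [IsProbabilityMeasure P]
  {ι : Type*} [Fintype ι] [DecidableEq ι]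

/-- The Cramér–Wold device for Gaussian limits. -/
lemma tendstoInDistribution_multivariateGaussian_of_inner {Y : ℕ → Ω → EuclideanSpace ℝ ι}
    (hY : ∀ k, AEMeasurable (Y k) P) {V : Matrix ι ι ℝ} (hV : V.PosSemidef)
    (hlim : ∀ t : EuclideanSpace ℝ ι,
      TendstoInDistribution (fun k ω => ⟪t, Y k ω⟫_ℝ) atTop id (fun _ => P)
        (gaussianReal 0 (⟪t, toEuclideanCLM (𝕜 := ℝ) V t⟫_ℝ).toNNReal)) :
    TendstoInDistribution Y atTop id (fun _ => P) (multivariateGaussian 0 V) := by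
  refine (tendstoInDistribution_id_iff_tendsto_charFun hY).2 fun t => ?_
  have hquad : 0 ≤ ⟪t, toEuclideanCLM (𝕜 := ℝ) V t⟫_ℝ := by
    rw [Matrix.inner_toEuclideanCLM]
    exact hV.dotProduct_mulVec_nonneg t
  have hone := (tendstoInDistribution_id_iff_tendsto_charFun
    (hlim t).forall_aemeasurable).1 (hlim t) 1
  simp_rw [charFun_map_eq_charFun_map_inner_one (hY _) t]
  convert hone using 2
  rw [charFun_multivariateGaussian hV, charFun_gaussianReal, Real.coe_toNNReal _ hquad,
    Matrix.inner_toEuclideanCLM]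
  simp

lemma map_toEuclideanCLM_multivariateGaussian {V : Matrix ι ι ℝ} (hV : V.PosSemidef)
    (M : Matrix ι ι ℝ) :
    (multivariateGaussian 0 V).map (toEuclideanCLM (𝕜 := ℝ) M) =
      multivariateGaussian 0 (M * V * M.conjTranspose) := by
  refine Measure.ext_of_charFun (funext fun t => ?_)
  have hadj : (toEuclideanCLM (𝕜 := ℝ) M).adjoint =
      toEuclideanCLM (𝕜 := ℝ) M.conjTranspose :=
    (map_star (toEuclideanCLM (𝕜 := ℝ)) M).symm
  have hquad :
      ⟪(toEuclideanCLM (𝕜 := ℝ) M).adjoint t,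
        toEuclideanCLM (𝕜 := ℝ) V ((toEuclideanCLM (𝕜 := ℝ) M).adjoint t)⟫_ℝ =
      ⟪t, toEuclideanCLM (𝕜 := ℝ) (M * V * M.conjTranspose) t⟫_ℝ := by
    rw [ContinuousLinearMap.adjoint_inner_left, hadj, map_mul, map_mul]
    rfl
  rw [Matrix.inner_toEuclideanCLM, Matrix.inner_toEuclideanCLM] at hquad
  rw [charFun_map_clm, charFun_multivariateGaussian hV,
    charFun_multivariateGaussian (hV.mul_mul_conjTranspose_same M), hquad, inner_zero_right,
    inner_zero_right]

end Gaussian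

section OneSample

variable {Ω : Type*} [MeasurableSpace Ω] {P : Measure Ω} [IsProbabilityMeasure P]
  {𝒳 : Type*} [MeasurableSpace 𝒳] {G : Measure 𝒳} {X : ℕ → Ω → 𝒳}

lemma tendstoInDistribution_inv_sqrt_mul_sum_centered (hX : ∀ j, HasLaw (X j) G P)
    (hind : iIndepFun X P) {g : 𝒳 → ℝ} (hgm : Measurable g) (hg : MemLp g 2 G) {m : ℕ → ℕ}
    (hm : Tendsto m atTop atTop) :
    TendstoInDistribution
      (fun k ω => (√(m k))⁻¹ * ∑ j ∈ Finset.range (m k), centered G g (X j ω)) atTop id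
      (fun _ => P) (gaussianReal 0 Var[g; G].toNNReal) := by
  have hmean : ∫ ω, g (X 0 ω) ∂P = ∫ x, g x ∂G := (hX 0).integral_comp hg.aestronglyMeasurable
  have hvar : Var[fun ω => g (X 0 ω); P] = Var[g; G] := by
    conv_rhs => rw [← (hX 0).map_eq]
    exact (variance_map (by rw [(hX 0).map_eq]; exact hgm.aemeasurable) (hX 0).aemeasurable).symm
  have hclt := tendstoInDistribution_inv_sqrt_mul_sum_sub (X := fun j ω => g (X j ω))
    (HasLaw.id (μ := gaussianReal 0 Var[fun ω => g (X 0 ω); P].toNNReal))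
    (memLp_comp_of_hasLaw (hX 0) hg) (hind.comp (fun _ => g) fun _ => hgm)
    fun j => ((hX j).identDistrib (hX 0)).comp hgm
  have hcentered : ∀ k ω, ∑ j ∈ Finset.range k, g (X j ω) - k * ∫ ω, g (X 0 ω) ∂P =
      ∑ j ∈ Finset.range k, centered G g (X j ω) := fun k ω => by
    simp [centered, hmean, Finset.sum_sub_distrib]
  simp only [hvar, hcentered] at hclt
  exact ⟨fun k => hclt.forall_aemeasurable (m k), aemeasurable_id, hclt.tendsto.comp hm⟩

lemma tendstoInDistribution_mul_gaussianReal {Y : ℕ → Ω → ℝ} {v : NNReal}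
    (hY : TendstoInDistribution Y atTop id (fun _ => P) (gaussianReal 0 v)) {c : ℕ → ℝ} {c₀ : ℝ}
    (hc : Tendsto c atTop (𝓝 c₀)) :
    TendstoInDistribution (fun k ω => c k * Y k ω) atTop id (fun _ => P)
      (gaussianReal 0 (c₀ ^ 2 * v).toNNReal) := by
  have hc' : TendstoInMeasure P (fun k (_ : Ω) => c k) atTop fun _ => c₀ :=
    tendstoInMeasure_of_tendsto_ae (fun _ => aestronglyMeasurable_const) (ae_of_all _ fun _ => hc)
  refine tendstoInDistribution_id_of_hasLaw
    (hY.continuous_comp_prodMk_of_tendstoInMeasure_const (g := fun z : ℝ × ℝ => z.2 * z.1)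
      (by fun_prop) hc' fun _ => aemeasurable_const) ?_
  convert gaussianReal_const_mul HasLaw.id c₀ using 2
  · simp
  · exact NNReal.eq (by simp [Real.coe_toNNReal _ (show (0 : ℝ) ≤ c₀ ^ 2 * v by positivity)])

end OneSample

section TwoSamples

variable {Ω : Type*} [MeasurableSpace Ω] {P : Measure Ω} {𝒳 : Type*} [MeasurableSpace 𝒳]
  {G₁ G₂ : Measure 𝒳} {X₁ X₂ : ℕ → Ω → 𝒳}

lemma TwoSample.indepFun_sum (hX : TwoSample X₁ X₂ G₁ G₂ P) {g₁ g₂ : 𝒳 → ℝ}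
    (hg₁ : Measurable g₁) (hg₂ : Measurable g₂) (m₁ m₂ : ℕ) :
    IndepFun (fun ω => ∑ j ∈ Finset.range m₁, g₁ (X₁ j ω))
      (fun ω => ∑ j ∈ Finset.range m₂, g₂ (X₂ j ω)) P := by
  set Y : ℕ ⊕ ℕ → Ω → ℝ := Sum.elim (fun j ω => g₁ (X₁ j ω)) fun j ω => g₂ (X₂ j ω)
  set S : Finset (ℕ ⊕ ℕ) := (Finset.range m₁).map Function.Embedding.inl
  set T : Finset (ℕ ⊕ ℕ) := (Finset.range m₂).map Function.Embedding.inr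
  have hYm : ∀ s, AEMeasurable (Y s) P := by
    rintro (j | j)
    exacts [hg₁.comp_aemeasurable (hX.law₁ j).aemeasurable,
      hg₂.comp_aemeasurable (hX.law₂ j).aemeasurable]
  have hdisj : Disjoint S T := Finset.disjoint_map_inl_map_inr _ _
  have hind := ((hX.iIndepFun_comp hg₁ hg₂).indepFun_finset₀ S T hdisj hYm).comp
    (φ := fun v : S → ℝ => ∑ i, v i) (ψ := fun v : T → ℝ => ∑ i, v i) (by fun_prop) (by fun_prop)
  convert hind using 1 <;> funext ω
  · exact ((Finset.sum_coe_sort S (Y · ω)).trans (Finset.sum_map _ _ _)).symm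
  · exact ((Finset.sum_coe_sort T (Y · ω)).trans (Finset.sum_map _ _ _)).symm

variable [IsProbabilityMeasure P] {n₁ n₂ : ℕ → ℕ} {ρ : ℝ}

lemma tendstoInDistribution_localScale_mul_sampleSum_centered (hX : TwoSample X₁ X₂ G₁ G₂ P)
    (hn : SampleSizes n₁ n₂ ρ) {g₁ g₂ : 𝒳 → ℝ} (hm₁ : Measurable g₁) (hm₂ : Measurable g₂)
    (hg₁ : MemLp g₁ 2 G₁) (hg₂ : MemLp g₂ 2 G₂) :
    TendstoInDistribution (fun k ω => localScale (n₁ k) (n₂ k) *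
        sampleSum (centered G₁ g₁) (centered G₂ g₂) (n₁ k) (n₂ k) (X₁ · ω) (X₂ · ω))
      atTop id (fun _ => P)
      (gaussianReal 0 (ρ / (1 + ρ) * Var[g₁; G₁] + 1 / (1 + ρ) * Var[g₂; G₂]).toNNReal) := by
  have hρ := hn.pos
  have hlim₁ := tendstoInDistribution_mul_gaussianReal
    (tendstoInDistribution_inv_sqrt_mul_sum_centered hX.law₁ hX.iIndepFun_fst hm₁ hg₁
      hn.tendsto_fst) hn.tendsto_fst_div.sqrt
  have hlim₂ := tendstoInDistribution_mul_gaussianReal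
    (tendstoInDistribution_inv_sqrt_mul_sum_centered hX.law₂ hX.iIndepFun_snd hm₂ hg₂
      hn.tendsto_snd) hn.tendsto_snd_div.sqrt
  have hsum := tendstoInDistribution_add_of_indepFun hlim₁ hlim₂ fun k =>
    (hX.indepFun_sum (measurable_centered hm₁) (measurable_centered hm₂) (n₁ k) (n₂ k)).comp
      (φ := fun y => √((n₁ k : ℝ) / (n₁ k + n₂ k : ℕ)) * ((√(n₁ k))⁻¹ * y))
      (ψ := fun y => √((n₂ k : ℝ) / (n₁ k + n₂ k : ℕ)) * ((√(n₂ k))⁻¹ * y))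
      (by fun_prop) (by fun_prop)
  have hscale : ∀ (n m : ℕ) (f : ℕ → ℝ), √((m : ℝ) / n) * ((√m)⁻¹ * ∑ j ∈ Finset.range m, f j) =
      (√n)⁻¹ * ∑ j ∈ Finset.range m, f j := fun n m f => by
    rcases Nat.eq_zero_or_pos m with rfl | hm
    · simp
    · rw [Real.sqrt_div (Nat.cast_nonneg m)]
      field_simp
  have hlaw : HasLaw id (gaussianReal 0
      (ρ / (1 + ρ) * Var[g₁; G₁] + 1 / (1 + ρ) * Var[g₂; G₂]).toNNReal)
      (gaussianReal 0 (√(ρ / (1 + ρ)) ^ 2 * Var[g₁; G₁].toNNReal).toNNReal ∗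
        gaussianReal 0 (√(1 / (1 + ρ)) ^ 2 * Var[g₂; G₂].toNNReal).toNNReal) := by
    have hv₁ := variance_nonneg g₁ G₁
    have hv₂ := variance_nonneg g₂ G₂
    refine ⟨aemeasurable_id, ?_⟩
    rw [Measure.map_id, gaussianReal_conv_gaussianReal, add_zero, Real.sq_sqrt (by positivity),
      Real.sq_sqrt (by positivity), Real.coe_toNNReal _ hv₁, Real.coe_toNNReal _ hv₂,
      ← Real.toNNReal_add (by positivity) (by positivity)]
  simpa only [hscale, localScale, sampleSum, mul_add] using
    tendstoInDistribution_id_of_hasLaw hsum hlaw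

variable [IsProbabilityMeasure G₁] [IsProbabilityMeasure G₂] {ι : Type*} [Fintype ι]
  [DecidableEq ι]

lemma tendstoInDistribution_localScale_smul_sampleSum_centered (hX : TwoSample X₁ X₂ G₁ G₂ P)
    (hn : SampleSizes n₁ n₂ ρ) {f₁ f₂ : 𝒳 → EuclideanSpace ℝ ι} (hm₁ : Measurable f₁)
    (hm₂ : Measurable f₂) (hf₁ : MemLp f₁ 2 G₁) (hf₂ : MemLp f₂ 2 G₂) {V : Matrix ι ι ℝ}
    (hV : V.PosSemidef)
    (hquad : ∀ t, ⟪t, toEuclideanCLM (𝕜 := ℝ) V t⟫_ℝ =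
      ρ / (1 + ρ) * Var[fun x => ⟪t, f₁ x⟫_ℝ; G₁] + 1 / (1 + ρ) * Var[fun x => ⟪t, f₂ x⟫_ℝ; G₂]) :
    TendstoInDistribution (fun k ω => localScale (n₁ k) (n₂ k) •
        sampleSum (centered G₁ f₁) (centered G₂ f₂) (n₁ k) (n₂ k) (X₁ · ω) (X₂ · ω))
      atTop id (fun _ => P) (multivariateGaussian 0 V) := by
  refine tendstoInDistribution_multivariateGaussian_of_inner (fun k => ?_) hV fun t => ?_
  · exact ((memLp_sampleSum hX (memLp_centered hf₁) (memLp_centered hf₂) _ _).const_smul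
      (localScale (n₁ k) (n₂ k))).aestronglyMeasurable.aemeasurable
  · have hcentered : ∀ (G : Measure 𝒳) [IsProbabilityMeasure G] {f : 𝒳 → EuclideanSpace ℝ ι},
        MemLp f 2 G → ∀ x, centered G (fun x => ⟪t, f x⟫_ℝ) x = ⟪t, centered G f x⟫_ℝ :=
      fun G _ f hf x => by
        simp only [centered, inner_sub_right, integral_inner (hf.integrable (by norm_num))]
    have hlim := tendstoInDistribution_localScale_mul_sampleSum_centered hX hn
      (hm₁.const_inner (c := t)) (hm₂.const_inner (c := t)) (hf₁.const_inner t) (hf₂.const_inner t)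
    rw [hquad t]
    simpa only [sampleSum, hcentered G₁ hf₁, hcentered G₂ hf₂, inner_smul_right, inner_add_right,
      inner_sum] using hlim

end TwoSamples

section LinearImage

variable {Ω : Type*} [MeasurableSpace Ω] {P : Measure Ω} [IsProbabilityMeasure P]
  {ι : Type*} [Fintype ι] [DecidableEq ι]

lemma tendstoInDistribution_toEuclideanCLM_multivariateGaussian
    {Y : ℕ → Ω → EuclideanSpace ℝ ι} {V : Matrix ι ι ℝ} (hV : V.PosSemidef)
    (hY : TendstoInDistribution Y atTop id (fun _ => P) (multivariateGaussian 0 V))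
    (M : Matrix ι ι ℝ) :
    TendstoInDistribution (fun k ω => toEuclideanCLM (𝕜 := ℝ) M (Y k ω)) atTop id (fun _ => P)
      (multivariateGaussian 0 (M * V * M.conjTranspose)) :=
  tendstoInDistribution_id_of_hasLaw (hY.continuous_comp (toEuclideanCLM (𝕜 := ℝ) M).continuous)
    ⟨by fun_prop, map_toEuclideanCLM_multivariateGaussian hV M⟩

end LinearImage

end CentralLimit

/-! ### The information operator and the covariance of the score -/

section Measurability

lemma continuous_rankOne_self {E : Type*} [NormedAddCommGroup E] [InnerProductSpace ℝ E] :
    Continuous fun z : E => InnerProductSpace.rankOne ℝ z z :=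
  (InnerProductSpace.rankOne ℝ).continuous.clm_apply continuous_id

variable {𝒳 : Type*} [MeasurableSpace 𝒳] {d : ℕ} {h : 𝒳 → Fin d → ℝ} (hh : Measurable h)
include hh

lemma measurable_design : Measurable (design h) := by
  refine (WithLp.measurable_toLp 2 _).comp (measurable_pi_lambda _ (Fin.cases ?_ fun j => ?_))
  · exact measurable_const
  · exact (measurable_pi_apply j).comp hh

lemma measurable_linPred (θ : Param d) : Measurable (linPred h θ) := by
  simp only [funext (linPred_eq_inner h θ)]
  exact (measurable_design hh).const_inner

lemma measurable_sigmoid_linPred (γ : ℝ) (θ : Param d) :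
    Measurable fun x => sigmoid (linPred h θ x + γ) :=
  continuous_sigmoid.measurable.comp ((measurable_linPred hh θ).add_const γ)

lemma measurable_obsScore (γ y : ℝ) (θ : Param d) : Measurable (obsScore h γ y θ) :=
  ((measurable_sigmoid_linPred hh γ θ).const_sub y).smul (measurable_design hh)

lemma measurable_designOuter : Measurable (designOuter h) :=
  continuous_rankOne_self.measurable.comp (measurable_design hh)

lemma measurable_obsInfo (γ : ℝ) (θ : Param d) : Measurable (obsInfo h γ θ) :=
  (continuous_sigmoidDeriv.measurable.comp ((measurable_linPred hh θ).add_const γ)).smul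
    (measurable_designOuter hh)

end Measurability

section ChangeOfMeasure

lemma exp_linPred_mul_one_sub_sigmoid {𝒳 : Type*} {d : ℕ} (h : 𝒳 → Fin d → ℝ) (γ : ℝ)
    (θ : Param d) (x : 𝒳) :
    exp (linPred h θ x) * (1 - sigmoid (linPred h θ x + γ)) =
      exp (-γ) * sigmoid (linPred h θ x + γ) := by
  conv_rhs => rw [← exp_mul_one_sub_sigmoid]
  rw [← mul_assoc, ← exp_add]
  ring_nf

variable {𝒳 : Type*} [MeasurableSpace 𝒳] {d : ℕ} {h : 𝒳 → Fin d → ℝ} {θ : Param d}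
  {G₁ G₂ : Measure 𝒳} {E : Type*} [NormedAddCommGroup E] [NormedSpace ℝ E]

variable (hmodel : DensityRatioModel h θ G₁ G₂) (hh : Measurable h)
include hmodel hh

lemma DensityRatioModel.integral_one_sub_sigmoid_smul (γ : ℝ) (f : 𝒳 → E) :
    ∫ x, (1 - sigmoid (linPred h θ x + γ)) • f x ∂G₁ =
      exp (-γ) • ∫ x, sigmoid (linPred h θ x + γ) • f x ∂G₂ := by
  rw [hmodel, integral_withDensity_eq_integral_toReal_smul
    (measurable_linPred hh θ).exp.ennreal_ofReal (ae_of_all _ fun _ => ENNReal.ofReal_lt_top),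
    ← integral_smul]
  simp only [ENNReal.toReal_ofReal (exp_pos _).le, smul_smul, exp_linPred_mul_one_sub_sigmoid]

lemma DensityRatioModel.integrable_one_sub_sigmoid_smul_iff (γ : ℝ) (f : 𝒳 → E) :
    Integrable (fun x => (1 - sigmoid (linPred h θ x + γ)) • f x) G₁ ↔
      Integrable (fun x => sigmoid (linPred h θ x + γ) • f x) G₂ := by
  rw [hmodel, integrable_withDensity_iff_integrable_smul'
    (measurable_linPred hh θ).exp.ennreal_ofReal (ae_of_all _ fun _ => ENNReal.ofReal_lt_top),
    ← integrable_smul_iff (exp_ne_zero (-γ)) fun x => sigmoid (linPred h θ x + γ) • f x]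
  simp only [ENNReal.toReal_ofReal (exp_pos _).le, smul_smul, exp_linPred_mul_one_sub_sigmoid,
    Pi.smul_def]

variable {γ : ℝ} {f : 𝒳 → E}

lemma DensityRatioModel.integrable_sigmoid_sq_smul
    (hf₁ : Integrable (fun x => sigmoidDeriv (linPred h θ x + γ) • f x) G₁) :
    Integrable (fun x => sigmoid (linPred h θ x + γ) ^ 2 • f x) G₂ := by
  have hmeasure := (hmodel.integrable_one_sub_sigmoid_smul_iff hh γ fun x =>
    sigmoid (linPred h θ x + γ) • f x).1 (hf₁.congr (ae_of_all _ fun x => by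
      simp only [sigmoidDeriv, smul_smul, mul_comm]))
  simpa only [smul_smul, ← sq] using hmeasure

lemma DensityRatioModel.integral_sigmoid_sq_smul :
    ∫ x, sigmoid (linPred h θ x + γ) ^ 2 • f x ∂G₂ =
      exp γ • ∫ x, sigmoidDeriv (linPred h θ x + γ) • f x ∂G₁ := by
  have hmeasure := hmodel.integral_one_sub_sigmoid_smul hh γ fun x =>
    sigmoid (linPred h θ x + γ) • f x
  rw [exp_neg, eq_inv_smul_iff₀ (exp_ne_zero γ)] at hmeasure
  simpa only [sigmoidDeriv, smul_smul, sub_mul, mul_sub, one_mul, mul_one, ← sq] using hmeasure.symm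

lemma DensityRatioModel.integrable_sigmoid_smul
    (hf₁ : Integrable (fun x => sigmoidDeriv (linPred h θ x + γ) • f x) G₁)
    (hf₂ : Integrable (fun x => sigmoidDeriv (linPred h θ x + γ) • f x) G₂) :
    Integrable (fun x => sigmoid (linPred h θ x + γ) • f x) G₂ := by
  refine ((hmodel.integrable_sigmoid_sq_smul hh hf₁).add hf₂).congr (ae_of_all _ fun x => ?_)
  simp only [Pi.add_apply, sigmoidDeriv, ← add_smul]
  ring_nf

lemma DensityRatioModel.integral_sigmoid_smul
    (hf₁ : Integrable (fun x => sigmoidDeriv (linPred h θ x + γ) • f x) G₁)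
    (hf₂ : Integrable (fun x => sigmoidDeriv (linPred h θ x + γ) • f x) G₂) :
    ∫ x, sigmoid (linPred h θ x + γ) • f x ∂G₂ =
      exp γ • ∫ x, sigmoidDeriv (linPred h θ x + γ) • f x ∂G₁
        + ∫ x, sigmoidDeriv (linPred h θ x + γ) • f x ∂G₂ := by
  rw [← hmodel.integral_sigmoid_sq_smul hh,
    ← integral_add (hmodel.integrable_sigmoid_sq_smul hh hf₁) hf₂]
  congr 1 with x : 1
  rw [sigmoidDeriv, ← add_smul]
  ring_nf

end ChangeOfMeasure

section Information

open Matrix (toEuclideanCLM)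

variable {𝒳 : Type*} [MeasurableSpace 𝒳] {d : ℕ} {h : 𝒳 → Fin d → ℝ} {θ : Param d}
  {G₁ G₂ : Measure 𝒳} {ρ : ℝ}

/-- The density ratio model with a finite information operator at `θ`, for samples whose sizes
have ratio `ρ`. -/
structure FiniteInformation (h : 𝒳 → Fin d → ℝ) (ρ : ℝ) (θ : Param d) (G₁ G₂ : Measure 𝒳) :
    Prop where
  model : DensityRatioModel h θ G₁ G₂
  measurable : Measurable h
  pos : 0 < ρ
  integrable₁ : Integrable (obsInfo h (log ρ) θ) G₁
  integrable₂ : Integrable (obsInfo h (log ρ) θ) G₂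

lemma isHermitian_matA : (matA h ρ θ G₂).IsHermitian := by
  ext i j
  simp only [Matrix.conjTranspose_apply, star_trivial, matA, Matrix.of_apply,
    mul_comm (design h _ i)]

lemma isHermitian_matV : (matV h ρ θ G₂).IsHermitian := by
  refine (isHermitian_matA.smul (.all _)).sub (Matrix.IsHermitian.smul ?_ (.all _))
  ext i j
  simp [Matrix.vecMulVec_apply, mul_comm, ← isHermitian_matA.apply 0]

lemma inner_toEuclideanCLM_matV (t : Param d) :
    ⟪t, toEuclideanCLM (𝕜 := ℝ) (matV h ρ θ G₂) t⟫_ℝ =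
      ⟪t, toEuclideanCLM (𝕜 := ℝ) (matS h ρ θ G₂) t⟫_ℝ
        - ρ * ⟪t, toEuclideanCLM (𝕜 := ℝ) (matA h ρ θ G₂) (EuclideanSpace.single 0 1)⟫_ℝ ^ 2 := by
  have hcol : ∀ j, matA h ρ θ G₂ 0 j = matA h ρ θ G₂ j 0 := fun j =>
    (isHermitian_matA.apply 0 j).symm
  rw [matV, map_sub, sub_apply, inner_sub_right, matS]
  congr 1
  have ha : ⟪t, toEuclideanCLM (𝕜 := ℝ) (matA h ρ θ G₂) (EuclideanSpace.single 0 1)⟫_ℝ =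
      t.ofLp ⬝ᵥ fun i => matA h ρ θ G₂ i 0 := by
    simp only [Matrix.inner_toEuclideanCLM, PiLp.ofLp_single, Matrix.mulVec_single_one]
    rfl
  rw [map_smul, smul_apply, inner_smul_right, Matrix.inner_toEuclideanCLM,
    Matrix.vecMulVec_mulVec, funext hcol, ha, dotProduct_comm _ t.ofLp]
  simp [sq]

lemma inner_integral_obsInfo {G : Measure 𝒳} {γ : ℝ} (hint : Integrable (obsInfo h γ θ) G)
    (t : Param d) :
    ⟪t, (∫ x, obsInfo h γ θ x ∂G) t⟫_ℝ =
      ∫ x, sigmoidDeriv (linPred h θ x + γ) * ⟪t, design h x⟫_ℝ ^ 2 ∂G := by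
  simp only [← inner_obsInfo, ContinuousLinearMap.integral_apply hint]
  exact (integral_inner (hint.apply_continuousLinearMap t) t).symm

lemma posSemidef_of_inner_toEuclideanCLM_nonneg {n : Type*} [Fintype n] [DecidableEq n]
    {M : Matrix n n ℝ} (hM : M.IsHermitian)
    (hnonneg : ∀ v, 0 ≤ ⟪v, toEuclideanCLM (𝕜 := ℝ) M v⟫_ℝ) : M.PosSemidef :=
  .of_dotProduct_mulVec_nonneg hM fun v => by
    simpa only [Matrix.inner_toEuclideanCLM, star_trivial] using hnonneg (WithLp.toLp 2 v)

namespace FiniteInformation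

variable (H : FiniteInformation h ρ θ G₁ G₂)
include H

lemma integrable_sigmoid_smul_designOuter :
    Integrable (fun x => sigmoid (linPred h θ x + log ρ) • designOuter h x) G₂ :=
  H.model.integrable_sigmoid_smul H.measurable H.integrable₁ H.integrable₂

lemma smul_toEuclideanCLM_matA :
    ρ • toEuclideanCLM (𝕜 := ℝ) (matA h ρ θ G₂) =
      ∫ x, sigmoid (linPred h θ x + log ρ) • designOuter h x ∂G₂ := by
  refine ContinuousLinearMap.coe_injective
    ((EuclideanSpace.basisFun (Fin (d + 1)) ℝ).toBasis.ext fun j => PiLp.ext fun i => ?_)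
  have hproj := ((EuclideanSpace.proj i : Param d →L[ℝ] ℝ).comp
    (ContinuousLinearMap.apply ℝ (Param d) (EuclideanSpace.single j (1 : ℝ)))).integral_comp_comm
      H.integrable_sigmoid_smul_designOuter
  have hentry : ∀ x, ρ * (exp (linPred h θ x) / (1 + ρ * exp (linPred h θ x))
        * (design h x i * design h x j)) =
      sigmoid (linPred h θ x + log ρ) * (designOuter h x (EuclideanSpace.single j (1 : ℝ))) i :=
    fun x => by
      simp [designOuter_apply, EuclideanSpace.inner_single_right, sigmoid_eq_exp_div,
        ← mul_exp_eq_exp_add_log H.pos]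
      ring
  simpa [matA, ← integral_const_mul, hentry] using hproj

lemma toEuclideanCLM_matS :
    toEuclideanCLM (𝕜 := ℝ) (matS h ρ θ G₂) =
      (ρ / (1 + ρ)) • ∫ x, obsInfo h (log ρ) θ x ∂G₁
        + (1 / (1 + ρ)) • ∫ x, obsInfo h (log ρ) θ x ∂G₂ := by
  have hint := H.model.integral_sigmoid_smul H.measurable H.integrable₁ H.integrable₂
  rw [exp_log H.pos] at hint
  have hS : toEuclideanCLM (𝕜 := ℝ) (matS h ρ θ G₂) =
      (1 / (1 + ρ)) • ρ • toEuclideanCLM (𝕜 := ℝ) (matA h ρ θ G₂) := by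
    rw [matS, map_smul, smul_smul]
    ring_nf
  rw [hS, H.smul_toEuclideanCLM_matA, hint, smul_add, smul_smul,
    one_div_mul_eq_div]
  rfl

lemma integral_obsScore_one :
    ∫ x, obsScore h (log ρ) 1 θ x ∂G₁ =
      toEuclideanCLM (𝕜 := ℝ) (matA h ρ θ G₂) (EuclideanSpace.single 0 1) := by
  refine smul_right_injective _ H.pos.ne' ?_
  simp only [obsScore, H.model.integral_one_sub_sigmoid_smul H.measurable, exp_neg,
    exp_log H.pos, smul_inv_smul₀ H.pos.ne']
  rw [← smul_apply, H.smul_toEuclideanCLM_matA, ContinuousLinearMap.integral_apply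
    H.integrable_sigmoid_smul_designOuter]
  simp only [smul_apply, designOuter_single_zero]

lemma integral_obsScore_zero :
    ∫ x, obsScore h (log ρ) 0 θ x ∂G₂ =
      -(ρ • toEuclideanCLM (𝕜 := ℝ) (matA h ρ θ G₂) (EuclideanSpace.single 0 1)) := by
  have hchange := H.model.integral_one_sub_sigmoid_smul H.measurable (log ρ) (design h)
  rw [exp_neg, exp_log H.pos, eq_inv_smul_iff₀ H.pos.ne'] at hchange
  simp only [obsScore, zero_sub, neg_smul, integral_neg, ← hchange, ← H.integral_obsScore_one]

lemma memLp_obsScore_one : MemLp (obsScore h (log ρ) 1 θ) 2 G₁ := by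
  rw [memLp_two_iff_integrable_sq_norm
    (measurable_obsScore H.measurable _ _ _).aestronglyMeasurable]
  refine ((H.model.integrable_one_sub_sigmoid_smul_iff H.measurable (log ρ) fun x =>
    (1 - sigmoid (linPred h θ x + log ρ)) • ‖design h x‖ ^ 2).2
      (H.integrable₂.norm.congr (ae_of_all _ fun x => ?_))).congr (ae_of_all _ fun x => ?_)
  · simp only [norm_obsInfo, sigmoidDeriv, smul_eq_mul, mul_assoc]
  · simp only [obsScore, norm_smul, mul_pow, norm_eq_abs, sq_abs, smul_eq_mul]
    ring

lemma memLp_obsScore_zero : MemLp (obsScore h (log ρ) 0 θ) 2 G₂ := by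
  rw [memLp_two_iff_integrable_sq_norm
    (measurable_obsScore H.measurable _ _ _).aestronglyMeasurable]
  refine (H.model.integrable_sigmoid_sq_smul H.measurable (γ := log ρ)
    (f := fun x => ‖design h x‖ ^ 2)
      (H.integrable₁.norm.congr (ae_of_all _ fun x => ?_))).congr (ae_of_all _ fun x => ?_)
  · simp only [norm_obsInfo, smul_eq_mul]
  · simp only [obsScore, norm_smul, mul_pow, norm_eq_abs, sq_abs, smul_eq_mul, zero_sub, even_two,
      Even.neg_pow]

lemma mul_integral_inner_obsScore_one_sq (t : Param d) :
    ρ * ∫ x, ⟪t, obsScore h (log ρ) 1 θ x⟫_ℝ ^ 2 ∂G₁ =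
      ⟪t, (∫ x, obsInfo h (log ρ) θ x ∂G₂) t⟫_ℝ := by
  have hchange := H.model.integral_one_sub_sigmoid_smul H.measurable (log ρ) fun x =>
    (1 - sigmoid (linPred h θ x + log ρ)) * ⟪t, design h x⟫_ℝ ^ 2
  rw [exp_neg, exp_log H.pos, eq_inv_smul_iff₀ H.pos.ne'] at hchange
  rw [inner_integral_obsInfo H.integrable₂]
  simp only [sigmoidDeriv, mul_assoc]
  refine Eq.trans ?_ hchange
  simp only [obsScore, inner_smul_right, smul_eq_mul, mul_pow, ← mul_assoc, ← sq]

lemma integral_inner_obsScore_zero_sq (t : Param d) :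
    ∫ x, ⟪t, obsScore h (log ρ) 0 θ x⟫_ℝ ^ 2 ∂G₂ =
      ρ * ⟪t, (∫ x, obsInfo h (log ρ) θ x ∂G₁) t⟫_ℝ := by
  have hchange := H.model.integral_sigmoid_sq_smul H.measurable (γ := log ρ)
    (f := fun x => ⟪t, design h x⟫_ℝ ^ 2)
  rw [exp_log H.pos] at hchange
  rw [inner_integral_obsInfo H.integrable₁]
  simpa only [obsScore, inner_smul_right, mul_pow, zero_sub, even_two, Even.neg_pow,
    smul_eq_mul] using hchange

lemma inner_toEuclideanCLM_matV_eq_variance [IsProbabilityMeasure G₁] [IsProbabilityMeasure G₂]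
    (t : Param d) :
    ⟪t, toEuclideanCLM (𝕜 := ℝ) (matV h ρ θ G₂) t⟫_ℝ =
      ρ / (1 + ρ) * Var[fun x => ⟪t, obsScore h (log ρ) 1 θ x⟫_ℝ; G₁]
        + 1 / (1 + ρ) * Var[fun x => ⟪t, obsScore h (log ρ) 0 θ x⟫_ℝ; G₂] := by
  have h₁ := H.mul_integral_inner_obsScore_one_sq t
  have hρ := H.pos
  simp only [variance_eq_sub (H.memLp_obsScore_one.const_inner t),
    variance_eq_sub (H.memLp_obsScore_zero.const_inner t), Pi.pow_apply,
    H.integral_inner_obsScore_zero_sq,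
    integral_inner (H.memLp_obsScore_one.integrable one_le_two),
    integral_inner (H.memLp_obsScore_zero.integrable one_le_two), H.integral_obsScore_one,
    H.integral_obsScore_zero, inner_toEuclideanCLM_matV, H.toEuclideanCLM_matS, add_apply,
    smul_apply, inner_add_right, inner_smul_right, inner_neg_right]
  rw [← h₁]
  field_simp
  ring

lemma posSemidef_matV [IsProbabilityMeasure G₁] [IsProbabilityMeasure G₂] :
    (matV h ρ θ G₂).PosSemidef := by
  have hρ := H.pos
  refine posSemidef_of_inner_toEuclideanCLM_nonneg isHermitian_matV fun v => ?_
  rw [H.inner_toEuclideanCLM_matV_eq_variance]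
  exact add_nonneg (mul_nonneg (by positivity) (variance_nonneg _ _))
    (mul_nonneg (by positivity) (variance_nonneg _ _))

lemma posSemidef_matS : (matS h ρ θ G₂).PosSemidef := by
  have hρ := H.pos
  refine posSemidef_of_inner_toEuclideanCLM_nonneg (isHermitian_matA.smul (.all _)) fun v => ?_
  have hinfo : ∀ x, 0 ≤ sigmoidDeriv (linPred h θ x + log ρ) * ⟪v, design h x⟫_ℝ ^ 2 := fun x =>
    mul_nonneg (sigmoidDeriv_pos _).le (sq_nonneg _)
  rw [H.toEuclideanCLM_matS, add_apply, smul_apply, smul_apply, inner_add_right,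
    inner_smul_right, inner_smul_right, inner_integral_obsInfo H.integrable₁,
    inner_integral_obsInfo H.integrable₂]
  exact add_nonneg (mul_nonneg (by positivity) (integral_nonneg hinfo))
    (mul_nonneg (by positivity) (integral_nonneg hinfo))

lemma posDef_matS (hA : IsUnit (matA h ρ θ G₂)) : (matS h ρ θ G₂).PosDef := by
  have hρ := H.pos
  refine H.posSemidef_matS.posDef_iff_isUnit.2 ?_
  have hc : IsUnit (ρ / (1 + ρ)) := (by positivity : ρ / (1 + ρ) ≠ 0).isUnit
  exact hA.smul hc.unit

lemma posSemidef_asympCov [IsProbabilityMeasure G₁] [IsProbabilityMeasure G₂] :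
    (asympCov h ρ θ G₂).PosSemidef := by
  have hinv : ((matS h ρ θ G₂)⁻¹).conjTranspose = (matS h ρ θ G₂)⁻¹ :=
    H.posSemidef_matS.isHermitian.inv
  simpa only [asympCov, hinv] using
    H.posSemidef_matV.mul_mul_conjTranspose_same (matS h ρ θ G₂)⁻¹

end FiniteInformation

end Information

section Score

variable {Ω : Type*} [MeasurableSpace Ω] {P : Measure Ω} [IsProbabilityMeasure P]
  {𝒳 : Type*} [MeasurableSpace 𝒳] {d : ℕ} {h : 𝒳 → Fin d → ℝ} {θ : Param d}
  {G₁ G₂ : Measure 𝒳} {ρ : ℝ} {X₁ X₂ : ℕ → Ω → 𝒳} {n₁ n₂ : ℕ → ℕ}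

lemma DensityRatioModel.score_eq_sampleSum_centered (hmodel : DensityRatioModel h θ G₁ G₂)
    (hh : Measurable h) {m₁ m₂ : ℕ} (h₁ : 0 < m₁) (h₂ : 0 < m₂) (x₁ x₂ : ℕ → 𝒳) :
    score h (log (m₁ / m₂)) θ m₁ m₂ x₁ x₂ =
      sampleSum (centered G₁ (obsScore h (log (m₁ / m₂)) 1 θ))
        (centered G₂ (obsScore h (log (m₁ / m₂)) 0 θ)) m₁ m₂ x₁ x₂ := by
  have hratio : (0 : ℝ) < (m₁ : ℝ) / m₂ := by positivity
  have hbalance : (m₁ : ℝ) • ∫ x, obsScore h (log (m₁ / m₂)) 1 θ x ∂G₁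
      + (m₂ : ℝ) • ∫ x, obsScore h (log (m₁ / m₂)) 0 θ x ∂G₂ = 0 := by
    simp only [obsScore, hmodel.integral_one_sub_sigmoid_smul hh, exp_neg, exp_log hratio,
      smul_smul, zero_sub, neg_smul, integral_neg, smul_neg]
    rw [inv_div, mul_div_cancel₀ _ (Nat.cast_ne_zero.2 h₁.ne'), add_neg_cancel]
  simp only [score, sampleSum, centered, Finset.sum_sub_distrib, Finset.sum_const,
    Finset.card_range, ← Nat.cast_smul_eq_nsmul ℝ]
  rw [sub_add_sub_comm, hbalance, sub_zero]

section Perturbation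

variable {G : Measure 𝒳} {c : ℝ} (hh : Measurable h) (hint : Integrable (obsInfo h c θ) G)
include hh hint

lemma memLp_obsScore_sub (γ y : ℝ) :
    MemLp (fun x => obsScore h γ y θ x - obsScore h c y θ x) 2 G := by
  have hmeas : Measurable fun x => obsScore h γ y θ x - obsScore h c y θ x :=
    (measurable_obsScore hh γ y θ).sub (measurable_obsScore hh c y θ)
  rw [memLp_two_iff_integrable_sq_norm hmeas.aestronglyMeasurable]
  refine (hint.norm.const_mul ((|γ - c| * exp |γ - c|) ^ 2)).mono'
    (hmeas.norm.pow_const 2).aestronglyMeasurable (ae_of_all _ fun x => ?_)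
  rw [norm_of_nonneg (sq_nonneg _)]
  exact norm_obsScore_sub_sq_le h γ c y θ x

lemma tendsto_integral_norm_obsScore_sub_sq (y : ℝ) {γ : ℕ → ℝ} (hγ : Tendsto γ atTop (𝓝 c)) :
    Tendsto (fun k => ∫ x, ‖obsScore h (γ k) y θ x - obsScore h c y θ x‖ ^ 2 ∂G) atTop (𝓝 0) := by
  have hbound : ∀ k, ∫ x, ‖obsScore h (γ k) y θ x - obsScore h c y θ x‖ ^ 2 ∂G ≤
      (|γ k - c| * exp |γ k - c|) ^ 2 * ∫ x, ‖obsInfo h c θ x‖ ∂G := fun k => by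
    rw [← integral_const_mul]
    exact integral_mono (memLp_obsScore_sub hh hint _ y).norm.integrable_sq
      (hint.norm.const_mul _) (norm_obsScore_sub_sq_le h (γ k) c y θ)
  refine squeeze_zero (fun k => by positivity) hbound ?_
  have hcont : Continuous fun g : ℝ => (|g - c| * exp |g - c|) ^ 2 * ∫ x, ‖obsInfo h c θ x‖ ∂G := by
    fun_prop
  simpa [Function.comp_def] using (hcont.tendsto c).comp hγ

end Perturbation

namespace FiniteInformation

variable (H : FiniteInformation h ρ θ G₁ G₂)
include H

lemma memLp_obsScore (γ : ℝ) :
    MemLp (obsScore h γ 1 θ) 2 G₁ ∧ MemLp (obsScore h γ 0 θ) 2 G₂ :=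
  ⟨((memLp_obsScore_sub H.measurable H.integrable₁ γ 1).add H.memLp_obsScore_one).ae_eq
      (ae_of_all _ fun _ => sub_add_cancel _ _),
    ((memLp_obsScore_sub H.measurable H.integrable₂ γ 0).add H.memLp_obsScore_zero).ae_eq
      (ae_of_all _ fun _ => sub_add_cancel _ _)⟩

variable [IsProbabilityMeasure G₁] [IsProbabilityMeasure G₂]
  (hX : TwoSample X₁ X₂ G₁ G₂ P) (hn : SampleSizes n₁ n₂ ρ)
include hX hn

lemma tendstoInMeasure_score_sub :
    TendstoInMeasure P (fun k ω =>
      localScale (n₁ k) (n₂ k) •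
          score h (log (n₁ k / n₂ k)) θ (n₁ k) (n₂ k) (X₁ · ω) (X₂ · ω)
        - localScale (n₁ k) (n₂ k) •
          sampleSum (centered G₁ (obsScore h (log ρ) 1 θ)) (centered G₂ (obsScore h (log ρ) 0 θ))
            (n₁ k) (n₂ k) (X₁ · ω) (X₂ · ω)) atTop 0 := by
  have hstable := tendstoInMeasure_localScale_smul_sampleSum_centered hX
    (f₁ := fun k x => obsScore h (log (n₁ k / n₂ k)) 1 θ x - obsScore h (log ρ) 1 θ x)
    (f₂ := fun k x => obsScore h (log (n₁ k / n₂ k)) 0 θ x - obsScore h (log ρ) 0 θ x)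
    (fun k => (measurable_obsScore H.measurable (log (n₁ k / n₂ k)) 1 θ).sub
      (measurable_obsScore H.measurable (log ρ) 1 θ))
    (fun k => (measurable_obsScore H.measurable (log (n₁ k / n₂ k)) 0 θ).sub
      (measurable_obsScore H.measurable (log ρ) 0 θ))
    (fun k => memLp_obsScore_sub H.measurable H.integrable₁ _ 1)
    (fun k => memLp_obsScore_sub H.measurable H.integrable₂ _ 0)
    (tendsto_integral_norm_obsScore_sub_sq H.measurable H.integrable₁ 1 hn.tendsto_log_ratio)
    (tendsto_integral_norm_obsScore_sub_sq H.measurable H.integrable₂ 0 hn.tendsto_log_ratio)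
    n₁ n₂
  refine hstable.congr' ?_ EventuallyEq.rfl
  filter_upwards [hn.eventually_pos] with k ⟨h₁, h₂⟩
  refine ae_of_all _ fun ω => ?_
  obtain ⟨hγ₁, hγ₂⟩ := H.memLp_obsScore (log (n₁ k / n₂ k))
  obtain ⟨hρ₁, hρ₂⟩ := H.memLp_obsScore (log ρ)
  beta_reduce
  rw [centered_sub (hγ₁.integrable one_le_two) (hρ₁.integrable one_le_two),
    centered_sub (hγ₂.integrable one_le_two) (hρ₂.integrable one_le_two), sampleSum_sub, smul_sub,
    H.model.score_eq_sampleSum_centered H.measurable h₁ h₂]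

lemma tendstoInDistribution_score :
    TendstoInDistribution (fun k ω => localScale (n₁ k) (n₂ k) •
        score h (log (n₁ k / n₂ k)) θ (n₁ k) (n₂ k) (X₁ · ω) (X₂ · ω))
      atTop id (fun _ => P) (multivariateGaussian 0 (matV h ρ θ G₂)) := by
  refine tendstoInDistribution_of_tendstoInMeasure_sub _ _
    (tendstoInDistribution_localScale_smul_sampleSum_centered hX hn
      (measurable_obsScore H.measurable _ 1 θ) (measurable_obsScore H.measurable _ 0 θ)
      H.memLp_obsScore_one H.memLp_obsScore_zero H.posSemidef_matV
      H.inner_toEuclideanCLM_matV_eq_variance)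
    (H.tendstoInMeasure_score_sub hX hn) fun k => ?_
  obtain ⟨h₁, h₂⟩ := H.memLp_obsScore (log (n₁ k / n₂ k))
  exact ((memLp_sampleSum hX h₁ h₂ _ _).const_smul
    (localScale (n₁ k) (n₂ k))).aestronglyMeasurable.aemeasurable

end FiniteInformation

end Score

/-! ### Localization of the maximizer -/

section Tightness

variable {E Ω Ω' : Type*} [NormedAddCommGroup E] [InnerProductSpace ℝ E] [FiniteDimensional ℝ E]

lemma exists_pos_forall_mul_norm_sq_le_inner {T : E →L[ℝ] E} (hT : ∀ v, v ≠ 0 → 0 < ⟪v, T v⟫_ℝ) :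
    ∃ κ > 0, ∀ v, κ * ‖v‖ ^ 2 ≤ ⟪v, T v⟫_ℝ := by
  rcases subsingleton_or_nontrivial E with _ | _
  · exact ⟨1, one_pos, fun v => by simp [Subsingleton.elim v 0]⟩
  obtain ⟨u, hu, hmin⟩ := (isCompact_sphere (0 : E) 1).exists_isMinOn
    (NormedSpace.sphere_nonempty.2 zero_le_one) (f := fun v => ⟪v, T v⟫_ℝ) (by fun_prop)
  refine ⟨⟪u, T u⟫_ℝ, hT u (ne_zero_of_mem_unit_sphere ⟨u, hu⟩), fun v => ?_⟩
  rcases eq_or_ne v 0 with rfl | hv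
  · simp
  have hnorm : 0 < ‖v‖ := norm_pos_iff.2 hv
  have hsphere : ‖v‖⁻¹ • v ∈ Metric.sphere (0 : E) 1 := by
    rw [mem_sphere_zero_iff_norm, norm_smul, norm_inv, norm_norm, inv_mul_cancel₀ hnorm.ne']
  have hle : ⟪u, T u⟫_ℝ ≤ ‖v‖⁻¹ * (‖v‖⁻¹ * ⟪v, T v⟫_ℝ) := by
    simpa only [Set.mem_ofPred_eq, map_smul, real_inner_smul_left, real_inner_smul_right]
      using hmin hsphere
  calc ⟪u, T u⟫_ℝ * ‖v‖ ^ 2 ≤ ‖v‖⁻¹ * (‖v‖⁻¹ * ⟪v, T v⟫_ℝ) * ‖v‖ ^ 2 := by gcongr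
    _ = ⟪v, T v⟫_ℝ := by field_simp

variable [MeasurableSpace E] [BorelSpace E] [MeasurableSpace Ω] {P : Measure Ω}
  [IsProbabilityMeasure P] [MeasurableSpace Ω'] {Q : Measure Ω'} [IsProbabilityMeasure Q]

lemma exists_forall_measure_not_norm_le {W : ℕ → Ω → E} {Z : Ω' → E}
    (hW : TendstoInDistribution W atTop Z (fun _ => P) Q) {c : ENNReal} (hc : 0 < c) :
    ∃ M : ℝ, ∀ k, P {ω | ¬ ‖W k ω‖ ≤ M} ≤ c := by
  have : ∀ k, IsProbabilityMeasure (P.map (W k)) := fun k =>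
    Measure.isProbabilityMeasure_map (hW.forall_aemeasurable k)
  have := Measure.isProbabilityMeasure_map (μ := Q) hW.aemeasurable_limit
  have htight : IsTightMeasureSet (Set.range fun k => P.map (W k)) :=
    isTightMeasureSet_of_tendsto_charFun (f := charFun (Q.map Z)) (by fun_prop)
      (ProbabilityMeasure.tendsto_iff_tendsto_charFun.1 hW.tendsto)
  obtain ⟨K, hK, hKle⟩ := isTightMeasureSet_iff_exists_isCompact_measure_compl_le.1 htight c hc
  obtain ⟨M, hM⟩ := hK.isBounded.subset_closedBall 0
  refine ⟨M, fun k => le_trans ?_ (hKle _ ⟨k, rfl⟩)⟩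
  rw [Measure.map_apply_of_aemeasurable (hW.forall_aemeasurable k) hK.isClosed.measurableSet.compl]
  exact measure_mono fun ω hω hmem => hω (mem_closedBall_zero_iff.1 (hM hmem))

end Tightness

section Domination

variable {𝒳 : Type*} {d : ℕ} {h : 𝒳 → Fin d → ℝ} {θ₀ : Param d} {ρ : ℝ} {K : 𝒳 → ℝ}

lemma norm_obsInfo_log (hρ : 0 < ρ) (θ : Param d) (x : 𝒳) :
    ‖obsInfo h (log ρ) θ x‖ =
      ρ * exp (linPred h θ x) / (1 + ρ * exp (linPred h θ x)) ^ 2 * ‖design h x‖ ^ 2 := by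
  rw [norm_obsInfo, sigmoidDeriv_eq, ← mul_exp_eq_exp_add_log hρ]

lemma abs_infoModulus_le (δ : ℝ) (x : 𝒳) : |infoModulus h K δ x| ≤ 2 * |K x| := by
  rw [infoModulus, abs_mul]
  have hlow : -1 ≤ exp (δ * ‖design h x‖) - 1 := by linarith [exp_pos (δ * ‖design h x‖)]
  gcongr
  exact abs_le.2 ⟨le_min (by linarith) (by norm_num), min_le_right _ _⟩

variable [MeasurableSpace 𝒳] {G G₁ G₂ : Measure 𝒳}

lemma DominatedHessian.exists_norm_obsInfo_le (hreg : DominatedHessian h ρ θ₀ G₁ G₂) (hρ : 0 < ρ) :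
    ∃ r : ℝ, 0 < r ∧ ∃ K : 𝒳 → ℝ, Integrable K G₁ ∧ Integrable K G₂ ∧
      ∀ θ ∈ Metric.ball θ₀ r, ∀ x, ‖obsInfo h (log ρ) θ x‖ ≤ K x := by
  simpa only [DominatedHessian, norm_obsInfo_log hρ] using hreg

lemma DominatedHessian.finiteInformation (hreg : DominatedHessian h ρ θ₀ G₁ G₂)
    (hmodel : DensityRatioModel h θ₀ G₁ G₂) (hh : Measurable h) (hρ : 0 < ρ) :
    FiniteInformation h ρ θ₀ G₁ G₂ := by
  obtain ⟨r, hr, K, hK₁, hK₂, hK⟩ := hreg.exists_norm_obsInfo_le hρ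
  have hmeas := measurable_obsInfo hh (log ρ) θ₀
  have hbound := hK θ₀ (Metric.mem_ball_self hr)
  exact ⟨hmodel, hh, hρ, hK₁.mono' hmeas.aestronglyMeasurable (ae_of_all _ hbound),
    hK₂.mono' hmeas.aestronglyMeasurable (ae_of_all _ hbound)⟩

lemma aestronglyMeasurable_infoModulus (hh : Measurable h) (hK : Integrable K G) (δ : ℝ) :
    AEStronglyMeasurable (infoModulus h K δ) G :=
  (((((measurable_design hh).norm.const_mul δ).exp.sub_const 1).min
    measurable_const).aestronglyMeasurable).mul hK.aestronglyMeasurable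

lemma integrable_infoModulus (hh : Measurable h) (hK : Integrable K G) (δ : ℝ) :
    Integrable (infoModulus h K δ) G :=
  (hK.abs.const_mul 2).mono' (aestronglyMeasurable_infoModulus hh hK δ)
    (ae_of_all _ (abs_infoModulus_le δ))

lemma tendsto_integral_infoModulus (hh : Measurable h) (hK : Integrable K G) :
    Tendsto (fun δ => ∫ x, infoModulus h K δ x ∂G) (𝓝 0) (𝓝 0) := by
  have hpointwise : ∀ x, Tendsto (fun δ => infoModulus h K δ x) (𝓝 0) (𝓝 0) := fun x => by
    have hcont : Continuous fun δ => infoModulus h K δ x := by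
      unfold infoModulus
      fun_prop
    simpa [infoModulus] using hcont.tendsto 0
  simpa using tendsto_integral_filter_of_dominated_convergence _
    (Eventually.of_forall fun δ => aestronglyMeasurable_infoModulus hh hK δ)
    (Eventually.of_forall fun δ => ae_of_all G (abs_infoModulus_le δ))
    (hK.abs.const_mul 2) (ae_of_all _ hpointwise)

end Domination

section Localization

open Matrix (toEuclideanCLM)

variable {Ω : Type*} [MeasurableSpace Ω] {P : Measure Ω} [IsProbabilityMeasure P]
  {𝒳 : Type*} [MeasurableSpace 𝒳] {d : ℕ} {h : 𝒳 → Fin d → ℝ} {θ₀ : Param d}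
  {G₁ G₂ : Measure 𝒳} {ρ : ℝ} {X₁ X₂ : ℕ → Ω → 𝒳} {n₁ n₂ : ℕ → ℕ}

lemma exists_withHighProb_sampleMean_infoModulus_le (hX : TwoSample X₁ X₂ G₁ G₂ P)
    (hn : SampleSizes n₁ n₂ ρ) (hh : Measurable h) {K : 𝒳 → ℝ} (hK₁ : Integrable K G₁)
    (hK₂ : Integrable K G₂) {r e : ℝ} (hr : 0 < r) (he : 0 < e) :
    ∃ δ > 0, δ < r ∧ WithHighProb P fun k ω =>
      sampleMean (infoModulus h K δ) (infoModulus h K δ) (n₁ k) (n₂ k) (X₁ · ω) (X₂ · ω) ≤ e := by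
  set L : ℝ → ℝ := fun δ => (ρ / (1 + ρ)) • ∫ x, infoModulus h K δ x ∂G₁
    + (1 / (1 + ρ)) • ∫ x, infoModulus h K δ x ∂G₂
  have hL : Tendsto L (𝓝 0) (𝓝 0) := by
    simpa only [smul_zero, add_zero] using
      ((tendsto_integral_infoModulus hh hK₁).const_smul (ρ / (1 + ρ))).add
      ((tendsto_integral_infoModulus hh hK₂).const_smul (1 / (1 + ρ)))
  obtain ⟨δ, hδ, hδr, hLδ⟩ : ∃ δ > 0, δ < r ∧ L δ < e :=
    ((eventually_mem_nhdsWithin (s := Set.Ioi (0 : ℝ))).and (nhdsWithin_le_nhds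
      ((eventually_lt_nhds hr).and (hL.eventually_lt_const he)))).exists
  refine ⟨δ, hδ, hδr, (tendstoInMeasure_iff_withHighProb.1 (tendstoInMeasure_sampleMean hX hn
    (integrable_infoModulus hh hK₁ δ) (integrable_infoModulus hh hK₂ δ)) _
    (sub_pos.2 hLδ)).mono (Eventually.of_forall fun k ω hω => ?_)⟩
  linarith [(abs_lt.1 hω).2]

variable (h ρ G₂) in
/-- The maximizer `S⁻¹ (n^{-1/2} U - λ₀ b)`, with `U` the score at `θ₀`, of the quadratic
approximation to the penalized log-likelihood in the local coordinate `u = √n (θ - θ₀)`. -/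
def localCenter (lam₀ : ℝ) (b : Param d) (m₁ m₂ : ℕ) (x₁ x₂ : ℕ → 𝒳) (θ₀ : Param d) : Param d :=
  toEuclideanCLM (𝕜 := ℝ) (matS h ρ θ₀ G₂)⁻¹
    (localScale m₁ m₂ • score h (log (m₁ / m₂)) θ₀ m₁ m₂ x₁ x₂ - lam₀ • b)

lemma toEuclideanCLM_matS_localCenter (hS : IsUnit (matS h ρ θ₀ G₂)) (lam₀ : ℝ) (b : Param d)
    (m₁ m₂ : ℕ) (x₁ x₂ : ℕ → 𝒳) :
    toEuclideanCLM (𝕜 := ℝ) (matS h ρ θ₀ G₂) (localCenter h G₂ ρ lam₀ b m₁ m₂ x₁ x₂ θ₀) =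
      localScale m₁ m₂ • score h (log (m₁ / m₂)) θ₀ m₁ m₂ x₁ x₂ - lam₀ • b := by
  rw [localCenter, ← mul_apply_eq_comp, ← map_mul,
    Matrix.mul_nonsing_inv _ ((Matrix.isUnit_iff_isUnit_det _).1 hS), map_one,
    one_apply_eq_self]

namespace FiniteInformation

variable (H : FiniteInformation h ρ θ₀ G₁ G₂) (hX : TwoSample X₁ X₂ G₁ G₂ P)
  (hn : SampleSizes n₁ n₂ ρ)
include H

lemma exists_pos_forall_mul_norm_sq_le_inner_matS (hA : IsUnit (matA h ρ θ₀ G₂)) :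
    ∃ κ > 0, ∀ v, κ * ‖v‖ ^ 2 ≤ ⟪v, toEuclideanCLM (𝕜 := ℝ) (matS h ρ θ₀ G₂) v⟫_ℝ := by
  refine exists_pos_forall_mul_norm_sq_le_inner fun v hv => ?_
  rw [Matrix.inner_toEuclideanCLM]
  simpa only [star_trivial] using (H.posDef_matS hA).dotProduct_mulVec_pos (by simpa using hv)

include hX hn

lemma withHighProb_norm_sampleMean_obsInfo_sub_lt {e : ℝ} (he : 0 < e) :
    WithHighProb P fun k ω => ‖sampleMean (obsInfo h (log ρ) θ₀) (obsInfo h (log ρ) θ₀)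
      (n₁ k) (n₂ k) (X₁ · ω) (X₂ · ω) - toEuclideanCLM (𝕜 := ℝ) (matS h ρ θ₀ G₂)‖ < e := by
  rw [H.toEuclideanCLM_matS]
  exact tendstoInMeasure_iff_withHighProb.1
    (tendstoInMeasure_sampleMean hX hn H.integrable₁ H.integrable₂) e he

variable {q : ℝ} {lam : ℕ → ℝ}

lemma withHighProb_strictConcaveOn_localPenLogLik (hA : IsUnit (matA h ρ θ₀ G₂)) (hq : 1 ≤ q)
    (hlam_nonneg : ∀ k, 0 ≤ lam k) :
    WithHighProb P fun k ω => StrictConcaveOn ℝ Set.univ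
      (localPenLogLik h q (lam k) (n₁ k) (n₂ k) (X₁ · ω) (X₂ · ω) θ₀) := by
  obtain ⟨κ, hκ, hTκ⟩ := H.exists_pos_forall_mul_norm_sq_le_inner_matS hA
  refine (H.withHighProb_norm_sampleMean_obsInfo_sub_lt hX hn hκ).mono
    (hn.eventually_pos.mono fun k ⟨h₁, h₂⟩ ω hinfo => ?_)
  exact strictConcaveOn_localPenLogLik hq (hlam_nonneg k) h₁ h₂ hTκ hinfo

variable {lam₀ : ℝ} (hA : IsUnit (matA h ρ θ₀ G₂)) (hq : 1 < q)
  (hlam : Tendsto (fun k => lam k / √((n₁ k + n₂ k : ℕ) : ℝ)) atTop (𝓝 lam₀))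
  (hreg : DominatedHessian h ρ θ₀ G₁ G₂)

include hA hq hlam hreg in
lemma withHighProb_abs_localPenLogLik_sub_quadModel_le (R : ℝ) {η : ℝ} (hη : 0 < η) :
    WithHighProb P fun k ω => ∀ u, ‖u‖ ≤ R →
      |localPenLogLik h q (lam k) (n₁ k) (n₂ k) (X₁ · ω) (X₂ · ω) θ₀ u
        - localPenLogLik h q (lam k) (n₁ k) (n₂ k) (X₁ · ω) (X₂ · ω) θ₀ 0
        - quadModel (toEuclideanCLM (𝕜 := ℝ) (matS h ρ θ₀ G₂))
            (localCenter h G₂ ρ lam₀ (gradient (bridgePenalty q) θ₀) (n₁ k) (n₂ k)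
              (X₁ · ω) (X₂ · ω) θ₀) u| ≤ η := by
  obtain ⟨r, hr, K, hK₁, hK₂, hK⟩ := hreg.exists_norm_obsInfo_le H.pos
  set e := η / (2 * (R ^ 2 + 1)) with he_def
  have he : 0 < e := by positivity
  have heη : 2 * (R ^ 2 + 1) * e = η := by
    rw [he_def]
    field_simp
  obtain ⟨δ, hδ, hδr, hmod⟩ :=
    exists_withHighProb_sampleMean_infoModulus_le hX hn H.measurable hK₁ hK₂ hr he
  have hradius : Tendsto (fun k => |log (n₁ k / n₂ k) - log ρ| + localScale (n₁ k) (n₂ k) * R)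
      atTop (𝓝 0) := by
    simpa using (hn.tendsto_log_ratio.sub_const (log ρ)).abs.add (hn.tendsto_localScale.mul_const R)
  refine (hmod.and (H.withHighProb_norm_sampleMean_obsInfo_sub_lt hX hn he)).mono ?_
  filter_upwards [hn.eventually_pos, hradius.eventually_le_const hδ,
    eventually_abs_penalty_expansion_le (differentiable_bridgePenalty hq θ₀) hn.tendsto_localScale
      hlam R he] with k ⟨h₁, h₂⟩ hδR hpen ω ⟨hmodω, hinfo⟩ u hu
  exact heη ▸ abs_localPenLogLik_sub_quadModel_le hK h₁ h₂ (toEuclideanCLM_matS_localCenter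
    (H.posDef_matS hA).isUnit _ _ _ _ _ _) hδr hδR hmodω hinfo.le (hpen u hu) hu

variable [IsProbabilityMeasure G₁] [IsProbabilityMeasure G₂]

include hA hq hlam hreg in
theorem withHighProb_existsUnique_isPenMaximizer (hlam_nonneg : ∀ k, 0 ≤ lam k) {ε : ℝ}
    (hε : 0 < ε) :
    WithHighProb P fun k ω =>
      (∃! θ, IsPenMaximizer h q (lam k) (n₁ k) (n₂ k) (X₁ · ω) (X₂ · ω) θ) ∧
      ∀ θ, IsPenMaximizer h q (lam k) (n₁ k) (n₂ k) (X₁ · ω) (X₂ · ω) θ →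
        ‖√((n₁ k + n₂ k : ℕ) : ℝ) • (θ - θ₀) - localCenter h G₂ ρ lam₀
          (gradient (bridgePenalty q) θ₀) (n₁ k) (n₂ k) (X₁ · ω) (X₂ · ω) θ₀‖ < ε := by
  obtain ⟨κ, hκ, hTκ⟩ := H.exists_pos_forall_mul_norm_sq_le_inner_matS hA
  have hcenter := (H.tendstoInDistribution_score hX hn).continuous_comp
    (g := fun v => toEuclideanCLM (𝕜 := ℝ) (matS h ρ θ₀ G₂)⁻¹
      (v - lam₀ • gradient (bridgePenalty q) θ₀)) (by fun_prop)
  refine (WithHighProb.existsUnique_isMaxOn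
    (Matrix.isSymmetric_toEuclideanLin_iff.2 (H.posDef_matS hA).isHermitian) hκ hTκ
    (H.withHighProb_strictConcaveOn_localPenLogLik hX hn hA hq.le hlam_nonneg)
    (fun R η => H.withHighProb_abs_localPenLogLik_sub_quadModel_le hX hn hA hq hlam hreg R)
    (fun c => exists_forall_measure_not_norm_le hcenter) hε).mono ?_
  filter_upwards [hn.eventually_pos] with k ⟨h₁, _⟩ ω ⟨hunique, hnear⟩
  exact ⟨(existsUnique_isPenMaximizer_iff h₁).2 hunique, fun θ hθ => hnear _ (hθ.isMaxOn_local h₁)⟩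

lemma tendstoInDistribution_localCenter_add (lam₀ : ℝ) (b : Param d) :
    TendstoInDistribution (fun k ω => localCenter h G₂ ρ lam₀ b (n₁ k) (n₂ k) (X₁ · ω) (X₂ · ω) θ₀
        + lam₀ • toEuclideanCLM (𝕜 := ℝ) (matS h ρ θ₀ G₂)⁻¹ b)
      atTop id (fun _ => P) (multivariateGaussian 0 (asympCov h ρ θ₀ G₂)) := by
  have hS : ((matS h ρ θ₀ G₂)⁻¹).conjTranspose = (matS h ρ θ₀ G₂)⁻¹ :=
    H.posSemidef_matS.isHermitian.inv
  simpa only [localCenter, map_sub, map_smul, sub_add_cancel, asympCov, hS] using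
    tendstoInDistribution_toEuclideanCLM_multivariateGaussian H.posSemidef_matV
      (H.tendstoInDistribution_score hX hn) (matS h ρ θ₀ G₂)⁻¹

include hA hq hlam hreg in
theorem tendstoInDistribution_isPenMaximizer (hlam_nonneg : ∀ k, 0 ≤ lam k) {θhat : ℕ → Ω → Param d}
    (hθmeas : ∀ k, AEMeasurable (θhat k) P)
    (hθmax : WithHighProb P fun k ω =>
      IsPenMaximizer h q (lam k) (n₁ k) (n₂ k) (X₁ · ω) (X₂ · ω) (θhat k ω)) :
    TendstoInDistribution (fun k ω => √((n₁ k + n₂ k : ℕ) : ℝ) • (θhat k ω - θ₀)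
        + lam₀ • toEuclideanCLM (𝕜 := ℝ) (matS h ρ θ₀ G₂)⁻¹ (gradient (bridgePenalty q) θ₀))
      atTop id (fun _ => P) (multivariateGaussian 0 (asympCov h ρ θ₀ G₂)) := by
  refine tendstoInDistribution_of_tendstoInMeasure_sub _ _
    (H.tendstoInDistribution_localCenter_add hX hn lam₀ (gradient (bridgePenalty q) θ₀))
    (tendstoInMeasure_iff_withHighProb.2 fun ε hε => ?_) (fun k => by fun_prop)
  have hloc := H.withHighProb_existsUnique_isPenMaximizer hX hn hA hq hlam hreg hlam_nonneg hε
  refine (hθmax.and hloc).mono (.of_forall fun k ω ⟨hmax, _, hnear⟩ => ?_)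
  simpa using hnear _ hmax

end FiniteInformation

end Localization

end DensityRatio

end

theorem theorem3p2
    {Ω : Type*} [MeasurableSpace Ω] (P : Measure Ω) [IsProbabilityMeasure P]
    {𝒳 : Type*} [MeasurableSpace 𝒳]
    (G₁ G₂ : Measure 𝒳) [IsProbabilityMeasure G₁] [IsProbabilityMeasure G₂]
    {d : ℕ} (h : 𝒳 → Fin d → ℝ) (hh : Measurable h)
    (θ₀ : DensityRatio.Param d)
    -- the density ratio model holds with true parameter `θ₀`
    (hmodel : DensityRatio.DensityRatioModel h θ₀ G₁ G₂)
    -- two independent random samples, from `G₁` and from `G₂`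
    (X₁ X₂ : ℕ → Ω → 𝒳)
    (hX₁ : ∀ j, HasLaw (X₁ j) G₁ P) (hX₂ : ∀ j, HasLaw (X₂ j) G₂ P)
    (hindep : iIndepFun (fun s : ℕ ⊕ ℕ => Sum.elim X₁ X₂ s) P)
    -- sample sizes: the total tends to infinity and the ratio tends to `ρ₁`
    (n₁ n₂ : ℕ → ℕ) (ρ₁ : ℝ) (hρ₁ : 0 < ρ₁)
    (hn : Tendsto (fun k => n₁ k + n₂ k) atTop atTop)
    (hratio : Tendsto (fun k => (n₁ k : ℝ) / (n₂ k : ℝ)) atTop (𝓝 ρ₁))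
    -- regularity conditions
    (hreg : DensityRatio.DominatedHessian h ρ₁ θ₀ G₁ G₂)
    (hA : IsUnit (DensityRatio.matA h ρ₁ θ₀ G₂))
    -- penalty and regularization parameters
    (q : ℝ) (hq : 1 < q)
    (lam : ℕ → ℝ) (hlam_nonneg : ∀ k, 0 ≤ lam k) (lam₀ : ℝ)
    (hlam : Tendsto (fun k => lam k / √((n₁ k + n₂ k : ℕ) : ℝ)) atTop (𝓝 lam₀)) :
    -- the limiting covariance matrix is a covariance matrix
    (DensityRatio.asympCov h ρ₁ θ₀ G₂).PosSemidef ∧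
    -- with probability tending to one there is a unique maximizer
    Tendsto (fun k => P {ω | ¬ ∃! θ : DensityRatio.Param d,
        DensityRatio.IsPenMaximizer h q (lam k) (n₁ k) (n₂ k)
          (fun j => X₁ j ω) (fun j => X₂ j ω) θ}) atTop (𝓝 0) ∧
    -- and the estimator is asymptotically normal
    ∀ θhat : ℕ → Ω → DensityRatio.Param d,
      (∀ k, AEMeasurable (θhat k) P) →
      Tendsto (fun k => P {ω | ¬ DensityRatio.IsPenMaximizer h q (lam k) (n₁ k) (n₂ k)
          (fun j => X₁ j ω) (fun j => X₂ j ω) (θhat k ω)}) atTop (𝓝 0) →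
      TendstoInDistribution
        (fun (k : ℕ) (ω : Ω) =>
          √((n₁ k + n₂ k : ℕ) : ℝ) • (θhat k ω - θ₀)
            + lam₀ • Matrix.toEuclideanLin (DensityRatio.matS h ρ₁ θ₀ G₂)⁻¹
                (gradient (DensityRatio.bridgePenalty q) θ₀))
        atTop id (fun _ => P)
        (multivariateGaussian (0 : DensityRatio.Param d) (DensityRatio.asympCov h ρ₁ θ₀ G₂)) ∧
      (lam₀ = 0 →
        TendstoInDistribution
          (fun (k : ℕ) (ω : Ω) => √((n₁ k + n₂ k : ℕ) : ℝ) • (θhat k ω - θ₀))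
          atTop id (fun _ => P)
          (multivariateGaussian (0 : DensityRatio.Param d)
            (DensityRatio.asympCov h ρ₁ θ₀ G₂))) := by
  have hX : DensityRatio.TwoSample X₁ X₂ G₁ G₂ P := ⟨hX₁, hX₂, hindep⟩
  have hsizes : DensityRatio.SampleSizes n₁ n₂ ρ₁ := ⟨hρ₁, hn, hratio⟩
  have hinfo := hreg.finiteInformation hmodel hh hρ₁
  refine ⟨hinfo.posSemidef_asympCov, ?_, fun θhat hθmeas hθmax => ?_⟩
  · exact (hinfo.withHighProb_existsUnique_isPenMaximizer hX hsizes hA hq hlam hreg hlam_nonneg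
      one_pos).mono (.of_forall fun k ω hω => hω.1)
  have hlimit := hinfo.tendstoInDistribution_isPenMaximizer hX hsizes hA hq hlam hreg hlam_nonneg
    hθmeas hθmax
  simp only [← ContinuousLinearMap.coe_coe, Matrix.coe_toEuclideanCLM_eq_toEuclideanLin] at hlimit
  exact ⟨hlimit, fun h₀ => by simpa only [h₀, zero_smul, add_zero] using hlimit⟩
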